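/- Let $k$ be a field. A toric variety over $k$ is a normal, separated, integral scheme $X$ of finite type over $k$ together with an open immersion $T_X\hookrightarrow X$ of a split torus $T_X\cong\mathbb G_m^n$ and an action of $T_X$ on $X$ extending the multiplication of $T_X$. A torus equivariant morphism $X\to X'$ is a $k$-morphism which restricts to a group homomorphism $T_X\to T_{X'}$ and is equivariant with respect to it. A toric fiber product is a fiber product in the category of toric varieties and torus equivariant morphisms (equivalently, in the category of fans). Let $X\to B$ and $Y\to B$ be torus equivariant morphisms of toric varieties over $k$, and let $F=X\times_B Y$ be the scheme-theoretic fiber product. Let $T$ be the fiber product of the dense tori $T_X$ and $T_Y$ over $T_B$ in the category of split tori, i.e. the identity component, with its reduced structure, of the scheme-theoretic fiber product $T_X\times_{T_B}T_Y$ (so $T=T_X\times_{T_B}T_Y$ whenever the latter is connected and reduced), and let $\overline F$ be the closure of $T$ in $F$. Then the toric fiber product of $X$ and $Y$ over $B$ exists, and it is the normalization of $\overline F$: there are a toric variety $F^{tor}$ and torus equivariant morphisms $p\colon F^{tor}\to X$, $q\colon F^{tor}\to Y$ exhibiting $F^{tor}$ as the fiber product of $X$ and $Y$ over $B$ in the category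 of toric varieties, and the morphism $(p,q)\colon F^{tor}\to F$ factors through a morphism $\nu\colon F^{tor}\to\overline F$ which is the normalization of the integral scheme $\overline F$. -/

import Mathlib

open CategoryTheory Limits MonoidalCategory CartesianMonoidalCategory MonObj AlgebraicGeometry

universe u

noncomputable section

/-- A scheme is normal if all its local rings are integrally closed domains. -/
class IsNormalScheme (X : Scheme.{u}) : Prop where
  isDomain_stalk : ∀ x : X, IsDomain (X.presheaf.stalk x)
  isIntegrallyClosed_stalk : ∀ x : X, IsIntegrallyClosed (X.presheaf.stalk x)

/-- `ν : W ⟶ Z` is the normalization of the integral scheme `Z`: `W` is integral and normal, and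
`ν` is an integral morphism which is birational, i.e. maps the generic point to the generic point
and induces an isomorphism of function fields. -/
structure IsNormalization {W Z : Scheme.{u}} (ν : W ⟶ Z) : Prop where
  [isIntegral_source : IsIntegral W]
  [isIntegral_target : IsIntegral Z]
  isNormal : IsNormalScheme W
  isIntegralHom : IsIntegralHom ν
  map_genericPoint : ν (genericPoint W) = genericPoint Z
  isIso_functionField : IsIso (ν.stalkMap (genericPoint W))

variable (k : Type u) [Field k]

/-- The split torus `𝔾ₘⁿ = Spec k[ℤⁿ]` over the field `k`. -/
def SplitTorus (n : ℕ) : Over (Spec (.of k)) :=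
  (Spec (.of (AddMonoidAlgebra k (Fin n → ℤ)))).asOver (Spec (.of k))

/-- The group structure of `𝔾ₘⁿ` is given by the usual Hopf algebra structure of the group
algebra. -/
instance (n : ℕ) : GrpObj (SplitTorus k n) :=
  inferInstanceAs
    (GrpObj ((Spec (.of (AddMonoidAlgebra k (Fin n → ℤ)))).asOver (Spec (.of k))))

/-- A (normal) toric variety over the field `k`: a normal, separated, integral scheme `carrier` of
finite type over `k`, together with an open immersion of a split torus `torus` and an action of the
torus on `carrier` which extends the translation action of the torus on itself.
(The torus is automatically dense.) -/
structure ToricVariety where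
  carrier : Over (Spec (.of k))
  [isIntegral : IsIntegral carrier.left]
  [isNormal : IsNormalScheme carrier.left]
  [isSeparated : IsSeparated carrier.hom]
  [locallyOfFiniteType : LocallyOfFiniteType carrier.hom]
  [quasiCompact : QuasiCompact carrier.hom]
  torus : Over (Spec (.of k))
  [grpObj : GrpObj torus]
  isSplit : ∃ (n : ℕ) (e : torus ≅ SplitTorus k n), IsMonHom e.hom
  incl : torus ⟶ carrier
  [isOpenImmersion : IsOpenImmersion incl.left]
  act : torus ⊗ carrier ⟶ carrier
  one_act : η[torus] ▷ carrier ≫ act = (λ_ carrier).hom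
  mul_act : μ[torus] ▷ carrier ≫ act = (α_ torus torus carrier).hom ≫ torus ◁ act ≫ act
  act_incl : torus ◁ incl ≫ act = μ[torus] ≫ incl

namespace ToricVariety

attribute [instance] isIntegral isNormal isSeparated locallyOfFiniteType quasiCompact grpObj
  isOpenImmersion

variable {k}

/-- A torus equivariant morphism of toric varieties: a morphism over `k` which restricts to a
homomorphism of the dense tori and is equivariant with respect to it. -/
@[ext]
structure Hom (X Y : ToricVariety k) where
  hom : X.carrier ⟶ Y.carrier
  torusHom : X.torus ⟶ Y.torus
  [isMonHom : IsMonHom torusHom]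
  incl_hom : X.incl ≫ hom = torusHom ≫ Y.incl
  act_hom : X.act ≫ hom = (torusHom ⊗ₘ hom) ≫ Y.act

attribute [instance] Hom.isMonHom

/-- The category of toric varieties over `k` and torus equivariant morphisms. -/
instance : Category (ToricVariety k) where
  Hom := Hom
  id X :=
    { hom := 𝟙 X.carrier
      torusHom := 𝟙 X.torus
      incl_hom := by simp
      act_hom := by simp }
  comp {X Y Z} f g :=
    { hom := f.hom ≫ g.hom
      torusHom := f.torusHom ≫ g.torusHom
      incl_hom := by rw [← Category.assoc, f.incl_hom, Category.assoc, g.incl_hom, Category.assoc]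
      act_hom := by
        rw [← Category.assoc, f.act_hom, Category.assoc, g.act_hom, ← Category.assoc,
          tensorHom_comp_tensorHom] }
  id_comp f := Hom.ext (Category.id_comp f.hom) (Category.id_comp f.torusHom)
  comp_id f := Hom.ext (Category.comp_id f.hom) (Category.comp_id f.torusHom)
  assoc f g h := Hom.ext (Category.assoc f.hom g.hom h.hom)
    (Category.assoc f.torusHom g.torusHom h.torusHom)

/-- The underlying scheme of a toric variety. -/
abbrev scheme (X : ToricVariety k) : Scheme.{u} := X.carrier.left

/-- The underlying morphism of schemes of a torus equivariant morphism. -/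
abbrev schemeHom {X Y : ToricVariety k} (f : X ⟶ Y) : X.scheme ⟶ Y.scheme :=
  (Hom.hom f).left

/-- The morphism of schemes between the dense tori underlying a torus equivariant morphism. -/
abbrev torusSchemeHom {X Y : ToricVariety k} (f : X ⟶ Y) : X.torus.left ⟶ Y.torus.left :=
  (Hom.torusHom f).left

section FiberProduct

variable {X Y B : ToricVariety k} (f : X ⟶ B) (g : Y ⟶ B)

/-- The scheme-theoretic fiber product `F = X ×_B Y`. -/
abbrev schemeFiberProduct : Scheme.{u} := pullback (schemeHom f) (schemeHom g)

/-- The scheme-theoretic fiber product of the dense tori of `X` and `Y` over the dense torus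
of `B`. It is a diagonalizable group scheme, but need not be connected or reduced. -/
abbrev torusSchemeFiberProduct : Scheme.{u} := pullback (torusSchemeHom f) (torusSchemeHom g)

/-- The inclusion of the scheme-theoretic fiber product of the dense tori into `F`. -/
abbrev torusSchemeFiberProductι : torusSchemeFiberProduct f g ⟶ schemeFiberProduct f g :=
  pullback.map _ _ _ _ X.incl.left Y.incl.left B.incl.left
    (by rw [← Over.comp_left, ← Over.comp_left]; exact congr(($(Hom.incl_hom f)).left).symm)
    (by rw [← Over.comp_left, ← Over.comp_left]; exact congr(($(Hom.incl_hom g)).left).symm)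

/-- The unit section of the scheme-theoretic fiber product of the dense tori. -/
def torusSchemeFiberProductOne : Spec (.of k) ⟶ torusSchemeFiberProduct f g :=
  pullback.lift η[X.torus].left η[Y.torus].left (by
    rw [← Over.comp_left, ← Over.comp_left]
    exact congr(($((IsMonHom.one_hom (Hom.torusHom f)).trans
      (IsMonHom.one_hom (Hom.torusHom g)).symm)).left))

/-- The ideal sheaf of the identity component, with its reduced structure, of the
scheme-theoretic fiber product of the dense tori. -/
def identityComponentIdeal : (torusSchemeFiberProduct f g).IdealSheafData :=
  Scheme.IdealSheafData.vanishingIdeal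
    ⟨connectedComponent (torusSchemeFiberProductOne f g (IsLocalRing.closedPoint k)),
      isClosed_connectedComponent⟩

/-- The fiber product `T` of the dense tori in the category of (split) tori, namely the identity
component, with its reduced structure, of the scheme-theoretic fiber product of the dense tori.
It is the whole scheme-theoretic fiber product if and only if the latter is a torus. -/
def torusFiberProduct : Scheme.{u} := (identityComponentIdeal f g).subscheme

/-- The inclusion of `T` into `F = X ×_B Y`. -/
def torusFiberProductι : torusFiberProduct f g ⟶ schemeFiberProduct f g :=
  (identityComponentIdeal f g).subschemeι ≫ torusSchemeFiberProductι f g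

/-- The (scheme-theoretic) closure of `T` in `F = X ×_B Y`. -/
def torusClosure : Scheme.{u} := (torusFiberProductι f g).image

/-- The closed immersion of the closure of `T` into `F = X ×_B Y`. -/
def torusClosureι : torusClosure f g ⟶ schemeFiberProduct f g := (torusFiberProductι f g).imageι

end FiberProduct

end ToricVariety

end

section LaurentAlgebra

variable (k : Type*) [Field k] (n : ℕ)

/-- The inclusion of the polynomial ring in `n` variables into the group algebra of `ℤⁿ`. -/
noncomputable def MvPolynomial.toAddMonoidAlgebra :
    MvPolynomial (Fin n) k →ₐ[k] AddMonoidAlgebra k (Fin n → ℤ) :=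
  MvPolynomial.aeval fun i ↦ AddMonoidAlgebra.single (Pi.single i 1) 1

lemma MvPolynomial.toAddMonoidAlgebra_monomial (m : Fin n →₀ ℕ) (a : k) :
    toAddMonoidAlgebra k n (monomial m a) = AddMonoidAlgebra.single (fun i ↦ (m i : ℤ)) a := by
  rw [toAddMonoidAlgebra, aeval_monomial, Finsupp.prod_fintype _ _ (by simp)]
  simp_rw [AddMonoidAlgebra.single_pow, one_pow]
  have (s : Finset (Fin n)) : ∏ i ∈ s,
      AddMonoidAlgebra.single (m i • (Pi.single i 1 : Fin n → ℤ)) (1 : k) =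
      AddMonoidAlgebra.single (∑ i ∈ s, m i • (Pi.single i 1 : Fin n → ℤ)) (1 : k) := by
    classical
    induction s using Finset.induction_on with
    | empty => simp [AddMonoidAlgebra.one_def]
    | insert a s ha ih =>
      rw [Finset.prod_insert ha, Finset.sum_insert ha, ih, AddMonoidAlgebra.single_mul_single,
        _root_.one_mul]
  rw [this, AddMonoidAlgebra.coe_algebraMap]
  simp only [Function.comp, AddMonoidAlgebra.single_mul_single, zero_add, _root_.mul_one]
  congr 1
  · ext i
    simp [Finset.sum_apply, Pi.single_apply]

lemma MvPolynomial.toAddMonoidAlgebra_injective :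
    Function.Injective (toAddMonoidAlgebra k n) := by
  have hj : Function.Injective fun (m : Fin n →₀ ℕ) (i : Fin n) ↦ (m i : ℤ) := fun a b h ↦
    Finsupp.ext fun i ↦ by simpa using congr_fun h i
  intro x y hxy
  have key (x : MvPolynomial (Fin n) k) (m : Fin n →₀ ℕ) :
      (toAddMonoidAlgebra k n x).coeff (fun i ↦ (m i : ℤ)) = x.coeff m := by
    classical
    induction x using MvPolynomial.induction_on' with
    | monomial m' a =>
      rw [toAddMonoidAlgebra_monomial, coeff_monomial]
      simp only [AddMonoidAlgebra.coeff_single, Finsupp.single_apply]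
      exact if_congr hj.eq_iff rfl rfl
    | add p q hp hq => simp [hp, hq]
  ext m
  rw [← key, ← key, hxy]

lemma AddMonoidAlgebra.exists_mul_single_mem_range (z : AddMonoidAlgebra k (Fin n → ℤ)) :
    ∃ N : ℕ, ∀ M ≥ N, z * single (fun _ ↦ (M : ℤ)) 1 ∈
      (MvPolynomial.toAddMonoidAlgebra k n).range := by
  induction z using AddMonoidAlgebra.induction_linear with
  | zero => exact ⟨0, fun M _ ↦ by rw [zero_mul]; exact zero_mem _⟩
  | add x y hx hy =>
    obtain ⟨N₁, h₁⟩ := hx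
    obtain ⟨N₂, h₂⟩ := hy
    refine ⟨N₁ + N₂, fun M hM ↦ ?_⟩
    rw [add_mul]
    exact add_mem (h₁ M (by omega)) (h₂ M (by omega))
  | single m a =>
    refine ⟨∑ i, (m i).natAbs, fun M hM ↦ ?_⟩
    have h (i : Fin n) : 0 ≤ m i + M := by
      have := Finset.single_le_sum (f := fun i ↦ (m i).natAbs) (fun _ _ ↦ Nat.zero_le _)
        (Finset.mem_univ i)
      omega
    refine ⟨MvPolynomial.monomial (Finsupp.equivFunOnFinite.symm fun i ↦ (m i + M).toNat) a, ?_⟩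
    change MvPolynomial.toAddMonoidAlgebra k n _ = _
    rw [MvPolynomial.toAddMonoidAlgebra_monomial, single_mul_single, _root_.mul_one]
    congr 1
    ext i
    simpa using h i

lemma AddMonoidAlgebra.isLocalization_away :
    letI := (MvPolynomial.toAddMonoidAlgebra k n).toRingHom.toAlgebra
    IsLocalization.Away (∏ i : Fin n, (MvPolynomial.X i : MvPolynomial (Fin n) k))
      (AddMonoidAlgebra k (Fin n → ℤ)) := by
  let := (MvPolynomial.toAddMonoidAlgebra k n).toRingHom.toAlgebra
  have hX (M : ℕ) : algebraMap _ (AddMonoidAlgebra k (Fin n → ℤ))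
      ((∏ i : Fin n, (MvPolynomial.X i : MvPolynomial (Fin n) k)) ^ M) =
      single (fun _ ↦ (M : ℤ)) 1 := by
    change MvPolynomial.toAddMonoidAlgebra k n _ = _
    have : (∏ i : Fin n, (MvPolynomial.X i : MvPolynomial (Fin n) k)) ^ M =
        MvPolynomial.monomial (Finsupp.equivFunOnFinite.symm fun _ ↦ M) 1 := by
      rw [MvPolynomial.monomial_eq, Finsupp.prod_fintype _ _ (by simp)]
      simp [Finset.prod_pow]
    rw [this, MvPolynomial.toAddMonoidAlgebra_monomial]
    rfl
  refine ⟨?_, ?_, ?_⟩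
  · rintro ⟨_, M, rfl⟩
    simp only [hX]
    refine .of_mul_eq_one (single (fun _ ↦ -(M : ℤ)) 1) ?_
    rw [single_mul_single, one_def, _root_.mul_one]
    congr 1
    ext i
    simp
  · intro z
    obtain ⟨N, hN⟩ := exists_mul_single_mem_range k n z
    obtain ⟨w, hw⟩ := hN N le_rfl
    refine ⟨⟨w, ⟨_, N, rfl⟩⟩, ?_⟩
    simp only [hX]
    exact hw.symm
  · intro x y hxy
    exact ⟨1, by rw [MvPolynomial.toAddMonoidAlgebra_injective k n hxy]⟩

instance AddMonoidAlgebra.isDomain_int : IsDomain (AddMonoidAlgebra k (Fin n → ℤ)) where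

instance AddMonoidAlgebra.smooth_int : Algebra.Smooth k (AddMonoidAlgebra k (Fin n → ℤ)) := by
  let := (MvPolynomial.toAddMonoidAlgebra k n).toRingHom.toAlgebra
  have : IsScalarTower k (MvPolynomial (Fin n) k) (AddMonoidAlgebra k (Fin n → ℤ)) :=
    .of_algebraMap_eq' (MvPolynomial.toAddMonoidAlgebra k n).comp_algebraMap.symm
  have := isLocalization_away k n
  have : Algebra.Smooth (MvPolynomial (Fin n) k) (AddMonoidAlgebra k (Fin n → ℤ)) :=
    .of_isLocalization_Away (∏ i : Fin n, (MvPolynomial.X i : MvPolynomial (Fin n) k))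
  have : Algebra.Smooth k (MvPolynomial (Fin n) k) := ⟨inferInstance, inferInstance⟩
  exact .comp k (MvPolynomial (Fin n) k) _

instance AddMonoidAlgebra.isIntegrallyClosed_int :
    IsIntegrallyClosed (AddMonoidAlgebra k (Fin n → ℤ)) := by
  let := (MvPolynomial.toAddMonoidAlgebra k n).toRingHom.toAlgebra
  have := isLocalization_away k n
  have : IsIntegrallyClosed (MvPolynomial (Fin n) k) :=
    UniqueFactorizationMonoid.instIsIntegrallyClosed
  refine isIntegrallyClosed_of_isLocalization _
    (Submonoid.powers (∏ i : Fin n, (MvPolynomial.X i : MvPolynomial (Fin n) k))) ?_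
  refine powers_le_nonZeroDivisors_of_noZeroDivisors ?_
  exact Finset.prod_ne_zero_iff.mpr fun i _ ↦ MvPolynomial.X_ne_zero i

end LaurentAlgebra

section FiniteIntegralClosure

open MvPolynomial

lemma MvPolynomial.exists_pow_eq_expand_map {σ k k' : Type*} [Field k] [Field k'] [Algebra k k']
    (p e : ℕ) [ExpChar k' p] (c : MvPolynomial σ k)
    (hc : ∀ m, ∃ r : k', r ^ p ^ e = algebraMap k k' (c.coeff m)) :
    ∃ d : MvPolynomial σ k', d ^ p ^ e = expand (p ^ e) (map (algebraMap k k') c) := by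
  choose r hr using hc
  have : ExpChar (MvPolynomial σ k') p := expChar_of_injective_ringHom (C_injective σ k') p
  refine ⟨∑ m ∈ c.support, monomial m (r m), ?_⟩
  rw [sum_pow_char_pow]
  conv_rhs => rw [c.as_sum, map_sum, map_sum]
  refine Finset.sum_congr rfl fun m _ ↦ ?_
  rw [monomial_pow, hr, map_monomial, expand_monomial]

lemma MvPolynomial.finite_expand_comp_map {σ k k' : Type*} [Finite σ] [Field k] [Field k']
    [Algebra k k'] [FiniteDimensional k k'] {q : ℕ} (hq : 0 < q) :
    (((expand q : MvPolynomial σ k' →ₐ[k'] _) : MvPolynomial σ k' →+* MvPolynomial σ k').comp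
      (map (algebraMap k k'))).Finite := by
  refine RingHom.IsIntegral.to_finite ?_ ?_
  · intro x
    induction x using MvPolynomial.induction_on with
    | C a =>
      obtain ⟨f, hf, hfa⟩ := Algebra.IsIntegral.isIntegral (R := k) a
      refine ⟨f.map C, hf.map _, ?_⟩
      rw [Polynomial.eval₂_map]
      have : ((((expand q : MvPolynomial σ k' →ₐ[k'] _) :
          MvPolynomial σ k' →+* MvPolynomial σ k').comp (map (algebraMap k k'))).comp C) =
          (C : k' →+* MvPolynomial σ k').comp (algebraMap k k') := by
        ext a : 1; simp
      rw [this, ← Polynomial.hom_eval₂, hfa, map_zero]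
    | add f g hf hg => exact hf.add _ hg
    | mul_X f i hf =>
      refine hf.mul _ ?_
      let := (((expand q : MvPolynomial σ k' →ₐ[k'] _) :
        MvPolynomial σ k' →+* MvPolynomial σ k').comp (map (algebraMap k k'))).toAlgebra
      refine IsIntegral.of_pow (R := MvPolynomial σ k) hq ?_
      have hX : algebraMap (MvPolynomial σ k) (MvPolynomial σ k') (X i) = X i ^ q := by
        change (expand q : MvPolynomial σ k' →ₐ[k'] _) (map (algebraMap k k') (X i)) = _
        simp
      exact hX ▸ isIntegral_algebraMap
  · refine RingHom.FiniteType.of_comp_finiteType (f := (C : k →+* MvPolynomial σ k)) ?_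
    have : ((((expand q : MvPolynomial σ k' →ₐ[k'] _) :
          MvPolynomial σ k' →+* MvPolynomial σ k').comp (map (algebraMap k k'))).comp C) =
          (C : k' →+* MvPolynomial σ k').comp (algebraMap k k') := by
        ext a : 1; simp
    rw [this]
    refine RingHom.FiniteType.comp (g := C) ?_ ?_
    · exact RingHom.finiteType_algebraMap.mpr (inferInstance : Algebra.FiniteType k' (MvPolynomial σ k'))
    · exact RingHom.Finite.finiteType (RingHom.finite_algebraMap.mpr inferInstance)

lemma Field.exists_finiteDimensional_pow_eq (k : Type*) [Field k] (F : Finset k) {q : ℕ}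
    (hq : 0 < q) :
    ∃ k' : IntermediateField k (AlgebraicClosure k), FiniteDimensional k k' ∧
      ∀ c ∈ F, ∃ r : k', r ^ q = algebraMap k k' c := by
  choose r hr using fun c : k ↦
    IsAlgClosed.exists_pow_nat_eq (algebraMap k (AlgebraicClosure k) c) hq
  refine ⟨IntermediateField.adjoin k (r '' F), ?_, fun c hc ↦ ⟨⟨r c,
    IntermediateField.subset_adjoin _ _ ⟨c, hc, rfl⟩⟩, Subtype.ext (hr c)⟩⟩
  have := (F.finite_toSet.image r).to_subtype
  exact IntermediateField.finiteDimensional_adjoin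
    fun x _ ↦ Algebra.IsIntegral.isIntegral x

lemma MvPolynomial.isIntegrallyClosed_field (σ k : Type*) [Field k] :
    IsIntegrallyClosed (MvPolynomial σ k) :=
  UniqueFactorizationMonoid.instIsIntegrallyClosed

lemma MvPolynomial.finite_integralClosure_of_isPurelyInseparable {σ k : Type*} [Finite σ] [Field k]
    (Q E : Type*) [Field Q] [Field E] [Algebra (MvPolynomial σ k) Q]
    [IsFractionRing (MvPolynomial σ k) Q] [Algebra Q E] [Algebra (MvPolynomial σ k) E]
    [IsScalarTower (MvPolynomial σ k) Q E] [FiniteDimensional Q E] [IsPurelyInseparable Q E] :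
    Module.Finite (MvPolynomial σ k) (integralClosure (MvPolynomial σ k) E) := by
  classical
  set P := MvPolynomial σ k
  let p := ringExpChar Q
  have hQ : ExpChar Q p := inferInstance
  have : ExpChar k p := by
    have hi : Function.Injective ((algebraMap P Q).comp (C : k →+* P)) :=
      (IsFractionRing.injective P Q).comp (C_injective σ k)
    exact (RingHom.expChar_iff _ hi p).mpr hQ
  obtain ⟨s, b, hb⟩ := FiniteDimensional.exists_is_basis_integral P Q E
  let e := IsPurelyInseparable.exponent Q E
  have hc (x : s) : ∃ c : P, algebraMap P E c = b x ^ p ^ e := by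
    obtain ⟨y, hy⟩ := IsPurelyInseparable.exponent_def' Q p (b x)
    have : IsIntegral P y := by
      rw [← isIntegral_algebraMap_iff (algebraMap Q E).injective, hy]
      exact (hb x).pow _
    obtain ⟨c, rfl⟩ := IsIntegrallyClosed.isIntegral_iff.mp this
    exact ⟨c, by rw [← hy, IsScalarTower.algebraMap_apply P Q E]⟩
  choose c hc using hc
  have hp : 0 < p ^ e := pow_pos (expChar_pos Q p) _
  obtain ⟨k', _, hk'⟩ := Field.exists_finiteDimensional_pow_eq k
    (Finset.univ.biUnion fun x ↦ (c x).support.image (c x).coeff) hp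
  have : ExpChar k' p := expChar_of_injective_ringHom (algebraMap k k').injective p
  have hic : IsIntegrallyClosed (MvPolynomial σ k') := isIntegrallyClosed_field σ k'
  set P' := MvPolynomial σ k'
  let θ : P →+* P' :=
    ((expand (p ^ e) : P' →ₐ[k'] P') : P' →+* P').comp (map (algebraMap k k'))
  have hθ : Function.Injective θ :=
    (expand_injective hp).comp (map_injective _ (algebraMap k k').injective)
  have hd (x : s) : ∃ d : P', d ^ p ^ e = θ (c x) := by
    refine exists_pow_eq_expand_map p e (c x) fun m ↦ ?_
    by_cases hm : m ∈ (c x).support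
    · exact hk' _ (Finset.mem_biUnion.mpr ⟨x, Finset.mem_univ _, Finset.mem_image_of_mem _ hm⟩)
    · exact ⟨0, by rw [zero_pow hp.ne', notMem_support_iff.mp hm, map_zero]⟩
  choose d hd using hd
  obtain ⟨Q', _, _, _⟩ : ∃ (Q' : Type _) (_ : Field Q') (_ : Algebra P' Q'),
    IsFractionRing P' Q' := ⟨FractionRing P', inferInstance, inferInstance, inferInstance⟩
  obtain ⟨Ω, _, _, _⟩ : ∃ (Ω : Type _) (_ : Field Ω) (_ : Algebra Q' Ω), IsAlgClosed Ω :=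
    ⟨AlgebraicClosure Q', inferInstance, inferInstance, inferInstance⟩
  let : Algebra P' Ω := ((algebraMap Q' Ω).comp (algebraMap P' Q')).toAlgebra
  have : IsScalarTower P' Q' Ω := .of_algebraMap_eq' rfl
  let : Algebra P P' := θ.toAlgebra
  have : Module.Finite P P' := finite_expand_comp_map hp
  let : Algebra P Ω := ((algebraMap P' Ω).comp θ).toAlgebra
  have : IsScalarTower P P' Ω := .of_algebraMap_eq' rfl
  have hinj' : Function.Injective (algebraMap P' Ω) :=
    (algebraMap Q' Ω).injective.comp (IsFractionRing.injective P' Q')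
  have hinj : Function.Injective (algebraMap P Ω) := hinj'.comp hθ
  have hθQ : Function.Injective ((algebraMap P' Q').comp θ) :=
    (IsFractionRing.injective P' Q').comp hθ
  let : Algebra Q Q' := (IsFractionRing.lift hθQ).toAlgebra
  let : Algebra Q Ω := ((algebraMap Q' Ω).comp (algebraMap Q Q')).toAlgebra
  have : IsScalarTower Q Q' Ω := .of_algebraMap_eq' rfl
  have : IsScalarTower P Q Ω := .of_algebraMap_eq fun x ↦ by
    change _ = algebraMap Q' Ω (IsFractionRing.lift hθQ (algebraMap P Q x))
    rw [IsFractionRing.lift_algebraMap, RingHom.comp_apply, ← IsScalarTower.algebraMap_apply]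
    rfl
  let φ : E →ₐ[Q] Ω := IsAlgClosed.lift
  have hφb (x : s) : φ (b x) = algebraMap P' Ω (d x) := by
    have : ExpChar Ω p := expChar_of_injective_ringHom (algebraMap Q Ω).injective p
    refine iterateFrobenius_inj Ω p e ?_
    rw [iterateFrobenius_def, iterateFrobenius_def, ← map_pow φ, ← map_pow (algebraMap P' Ω), hd,
      ← hc,
      IsScalarTower.algebraMap_apply P Q E, φ.commutes, ← IsScalarTower.algebraMap_apply]
    rfl
  have hφ (a : E) : φ a ∈ Set.range (algebraMap Q' Ω) := by
    rw [← b.sum_repr a, map_sum]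
    change _ ∈ (algebraMap Q' Ω).range
    refine sum_mem fun x _ ↦ ?_
    rw [map_smul, Algebra.smul_def, hφb, IsScalarTower.algebraMap_apply Q Q' Ω,
      IsScalarTower.algebraMap_apply P' Q' Ω]
    exact mul_mem ⟨_, rfl⟩ ⟨_, rfl⟩
  have hφ' (a : integralClosure P E) :
      φ a ∈ LinearMap.range ((Algebra.linearMap P' Ω).restrictScalars P) := by
    have ha : IsIntegral P (φ a) := a.2.map (φ.restrictScalars P)
    obtain ⟨y, hy⟩ := hφ a
    have hy' : IsIntegral P' (algebraMap Q' Ω y) := hy ▸ ha.tower_top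
    rw [isIntegral_algebraMap_iff (algebraMap Q' Ω).injective] at hy'
    obtain ⟨z, rfl⟩ := IsIntegrallyClosed.isIntegral_iff.mp hy'
    exact ⟨z, by rw [← hy, ← IsScalarTower.algebraMap_apply]; rfl⟩
  let ψ : integralClosure P E →ₗ[P]
      LinearMap.range ((Algebra.linearMap P' Ω).restrictScalars P) :=
    LinearMap.codRestrict _
      ((φ.restrictScalars P).toLinearMap ∘ₗ (integralClosure P E).val.toLinearMap) hφ'
  refine Module.Finite.of_injective ψ fun x y hxy ↦ Subtype.ext (φ.injective ?_)
  exact congr_arg Subtype.val hxy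

lemma isPurelyInseparable_fixedField_top (Q N : Type*) [Field Q] [Field N] [Algebra Q N]
    [Normal Q N] : IsPurelyInseparable Q (IntermediateField.fixedField (⊤ : Subgroup Gal(N/Q))) := by
  classical
  rw [isPurelyInseparable_iff_natSepDegree_eq_one]
  intro x
  have hx : IsIntegral Q (x : N) := Algebra.IsIntegral.isIntegral _
  rw [← minpoly.algebraMap_eq (B' := N) Subtype.val_injective x,
    Polynomial.natSepDegree_eq_of_splits _ (Normal.splits inferInstance _),
    Finset.card_eq_one]
  refine ⟨x, ?_⟩
  ext y
  rw [Multiset.mem_toFinset, Finset.mem_singleton]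
  constructor
  · intro hy
    obtain ⟨τ, hτ⟩ := minpoly.exists_algEquiv_of_root' (K := Q) (L := N) (x := y) (y := x)
      hx.isAlgebraic (by simpa using (Polynomial.mem_aroots.mp hy).2)
    rw [← hτ]
    exact x.2 ⟨τ, trivial⟩
  · rintro rfl
    exact Polynomial.mem_aroots.mpr ⟨minpoly.ne_zero hx, minpoly.aeval _ _⟩

/-- A finite normal extension splits as a purely inseparable extension followed by a Galois one. -/
lemma exists_isPurelyInseparable_isGalois.{v, w} (Q : Type v) (L : Type w) [Field Q] [Field L] [Algebra Q L]
    [FiniteDimensional Q L] : ∃ (E N : Type w) (_ : Field E) (_ : Field N) (_ : Algebra Q E)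
      (_ : Algebra E N) (_ : Algebra Q N) (_ : IsScalarTower Q E N) (_ : L →ₐ[Q] N),
      FiniteDimensional Q N ∧ FiniteDimensional Q E ∧ IsPurelyInseparable Q E ∧ IsGalois E N := by
  let N := IntermediateField.normalClosure Q L (AlgebraicClosure L)
  exact ⟨IntermediateField.fixedField (⊤ : Subgroup Gal(N/Q)), N, inferInstance, inferInstance,
    inferInstance, inferInstance, inferInstance, inferInstance, IsScalarTower.toAlgHom Q L N,
    inferInstance, inferInstance, isPurelyInseparable_fixedField_top Q N,
    IsGalois.of_fixed_field N (⊤ : Subgroup Gal(N/Q))⟩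

lemma MvPolynomial.finite_integralClosure {σ k : Type*} [Finite σ] [Field k]
    (Q L : Type*) [Field Q] [Field L] [Algebra (MvPolynomial σ k) Q]
    [IsFractionRing (MvPolynomial σ k) Q] [Algebra Q L] [Algebra (MvPolynomial σ k) L]
    [IsScalarTower (MvPolynomial σ k) Q L] [FiniteDimensional Q L] :
    Module.Finite (MvPolynomial σ k) (integralClosure (MvPolynomial σ k) L) := by
  set P := MvPolynomial σ k
  obtain ⟨E, N, _, _, _, _, _, _, φ, _, _, _, _⟩ := exists_isPurelyInseparable_isGalois Q L
  let : Algebra P E := ((algebraMap Q E).comp (algebraMap P Q)).toAlgebra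
  have : IsScalarTower P Q E := .of_algebraMap_eq' rfl
  have h₁ : Module.Finite P (integralClosure P E) :=
    finite_integralClosure_of_isPurelyInseparable Q E
  let B := integralClosure P E
  have : IsNoetherianRing B := isNoetherian_of_tower P inferInstance
  have : IsIntegrallyClosedIn B E := inferInstance
  have hfr : IsFractionRing B E := integralClosure.isFractionRing_of_finite_extension Q E
  have : IsIntegrallyClosed B := .of_isIntegrallyClosed_of_isIntegrallyClosedIn _ E
  let : Algebra P N := ((algebraMap Q N).comp (algebraMap P Q)).toAlgebra
  have : IsScalarTower P Q N := .of_algebraMap_eq' rfl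
  have : IsScalarTower P E N := .to₁₃₄ P Q E N
  have : IsScalarTower P B N := .of_algebraMap_eq' (IsScalarTower.algebraMap_eq P E N)
  have : FiniteDimensional E N := .right Q E N
  have h₂ : Module.Finite B (integralClosure B N) :=
    IsIntegralClosure.finite B E N (integralClosure B N)
  have h₃ : Module.Finite P (integralClosure B N) := .trans B _
  have : IsNoetherian P (integralClosure B N) :=
    isNoetherian_of_isNoetherianRing_of_finite P (integralClosure B N)
  let ψ : integralClosure P L →ₗ[P] integralClosure B N :=
    { toFun x := ⟨φ x, (x.2.map (φ.restrictScalars P)).tower_top⟩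
      map_add' x y := Subtype.ext (by simp)
      map_smul' r x := Subtype.ext ((φ.restrictScalars P).toLinearMap.map_smul r x.1) }
  refine Module.Finite.of_injective ψ fun x y hxy ↦ Subtype.ext (φ.injective ?_)
  exact congr_arg Subtype.val hxy

/-- The integral closure of a domain of finite type over a field in a finite extension of its
fraction field is finite. -/
lemma finite_integralClosure_of_finiteType (k : Type*) [Field k] (A K L : Type*) [CommRing A]
    [IsDomain A] [Algebra k A] [Algebra.FiniteType k A] [Field K] [Algebra A K]
    [IsFractionRing A K] [Field L] [Algebra A L] [Algebra K L] [IsScalarTower A K L]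
    [FiniteDimensional K L] : Module.Finite A (integralClosure A L) := by
  obtain ⟨n, g, hg, hfin⟩ := exists_finite_inj_algHom_of_fg k A
  set P := MvPolynomial (Fin n) k
  let : Algebra P A := g.toRingHom.toAlgebra
  have : Module.Finite P A := hfin
  let Q := FractionRing P
  have hPK : Function.Injective ((algebraMap A K).comp (algebraMap P A)) :=
    (IsFractionRing.injective A K).comp hg
  let : Algebra P K := ((algebraMap A K).comp (algebraMap P A)).toAlgebra
  let : Algebra Q K := (IsFractionRing.lift hPK).toAlgebra
  have : IsScalarTower P A K := .of_algebraMap_eq' rfl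
  have : IsScalarTower P Q K := .of_algebraMap_eq fun x ↦
    (IsFractionRing.lift_algebraMap hPK x).symm
  have : FaithfulSMul P A := (faithfulSMul_iff_algebraMap_injective P A).mpr hg
  have : FiniteDimensional Q K := by
    have : Algebra.EssFiniteType A K := .of_isLocalization _ (nonZeroDivisors A)
    have : Algebra.EssFiniteType P K := .comp P A K
    have : Algebra.EssFiniteType Q K := .of_comp P Q K
    have : Algebra.IsAlgebraic A K := IsFractionRing.comap_isAlgebraic_iff (K := K).mpr inferInstance
    have : Algebra.IsAlgebraic P K := .trans P A K
    have : Algebra.IsAlgebraic Q K := IsFractionRing.comap_isAlgebraic_iff (A := P).mp inferInstance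
    exact Algebra.finite_of_essFiniteType_of_isAlgebraic
  let : Algebra P L := ((algebraMap K L).comp (algebraMap P K)).toAlgebra
  let : Algebra Q L := ((algebraMap K L).comp (algebraMap Q K)).toAlgebra
  have : IsScalarTower Q K L := .of_algebraMap_eq' rfl
  have : IsScalarTower P K L := .of_algebraMap_eq' rfl
  have : IsScalarTower P Q L := .to₁₂₄ P Q K L
  have : IsScalarTower P A L := .to₁₂₄ P A K L
  have : FiniteDimensional Q L := .trans Q K L
  have h := MvPolynomial.finite_integralClosure (σ := Fin n) (k := k) Q L
  have : IsNoetherian P (integralClosure P L) := isNoetherian_of_isNoetherianRing_of_finite _ _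
  let ψ : integralClosure A L →ₗ[P] integralClosure P L :=
    { toFun x := ⟨x, isIntegral_trans _ x.2⟩
      map_add' x y := rfl
      map_smul' r x := rfl }
  have : Module.Finite P (integralClosure A L) := Module.Finite.of_injective ψ fun x y hxy ↦
    Subtype.ext (congr_arg (fun z : integralClosure P L ↦ z.1) hxy)
  exact .of_restrictScalars_finite P A _

end FiniteIntegralClosure

section RootsOfUnity

lemma notMem_basicOpen_sub_one_of_mem_connectedComponent {X : Scheme.{u}} {k : Type u} [Field k]
    (f : X ⟶ Spec (.of k)) (h : Γ(X, ⊤)) {m : ℕ} (hm : 0 < m) (hh : h ^ m = 1) {x₀ x : X}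
    (hx₀ : x₀ ∉ X.basicOpen (h - 1)) (hx : x ∈ connectedComponent x₀) :
    x ∉ X.basicOpen (h - 1) := by
  let φ : k →+* Γ(X, ⊤) := ((Scheme.ΓSpecIso (.of k)).inv ≫ f.appTop).hom
  let : Algebra k Γ(X, ⊤) := φ.toAlgebra
  let R := Algebra.adjoin k {h}
  have hint : IsIntegral k h := .of_pow hm (hh ▸ isIntegral_one)
  have : Module.Finite k R := Algebra.finite_adjoin_simple_of_isIntegral hint
  have : IsArtinianRing R := isArtinian_of_tower k inferInstance
  let h' : R := ⟨h, Algebra.self_mem_adjoin_singleton k h⟩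
  let g : X ⟶ Spec (.of R) := X.toSpecΓ ≫ Spec.map (CommRingCat.ofHom R.val.toRingHom)
  have hg (y : X) : y ∉ X.basicOpen (h - 1) ↔ h' - 1 ∈ (g y).asIdeal := by
    have : X.basicOpen (h - 1) = g ⁻¹ᵁ (PrimeSpectrum.basicOpen (h' - 1)) := by
      rw [← X.toSpecΓ_preimage_basicOpen]
      rfl
    rw [this]
    change ¬ ¬ _ ↔ _
    rw [not_not]
  rw [hg] at hx₀ ⊢
  have hd : DiscreteTopology (Spec (.of R)) :=
    @IsArtinianRing.instDiscreteTopologyPrimeSpectrum R _ this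
  have : g x = g x₀ := by
    have hp : _root_.IsPreconnected (connectedComponent x₀) := isPreconnected_connectedComponent
    exact hp.constant (Y := Spec (.of R)) (f := g) g.continuous.continuousOn hx
      mem_connectedComponent
  rwa [this]

end RootsOfUnity

section Lattice

/-- The pushout of free abelian groups of finite rank modulo torsion. -/
lemma exists_lattice_pushout {b x y : ℕ} (α : (Fin b → ℤ) →+ (Fin x → ℤ))
    (β : (Fin b → ℤ) →+ (Fin y → ℤ)) :
    ∃ (n : ℕ) (p : (Fin x → ℤ) →+ (Fin n → ℤ)) (q : (Fin y → ℤ) →+ (Fin n → ℤ)),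
      p.comp α = q.comp β ∧ (∀ z, ∃ s t, p s + q t = z) ∧
      ∀ s t, p s + q t = 0 → ∃ m : ℕ, 0 < m ∧ ∃ w, m • s = α w ∧ m • t = -β w := by
  let f₀ : (Fin b → ℤ) →ₗ[ℤ] (Fin x → ℤ) × (Fin y → ℤ) :=
    LinearMap.prod α.toIntLinearMap (-β.toIntLinearMap)
  let M := ((Fin x → ℤ) × (Fin y → ℤ)) ⧸ LinearMap.range f₀
  let L := M ⧸ Submodule.torsion ℤ M
  have : Module.Free ℤ L := Module.free_of_finite_type_torsion_free'
  let e := (Module.finBasis ℤ L).equivFun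
  let π : (Fin x → ℤ) × (Fin y → ℤ) →ₗ[ℤ] (Fin (Module.finrank ℤ L) → ℤ) :=
    e.toLinearMap ∘ₗ (Submodule.torsion ℤ M).mkQ ∘ₗ (LinearMap.range f₀).mkQ
  have hπ (s t) : π (s, 0) + π (0, t) = π (s, t) := by rw [← map_add]; simp
  refine ⟨_, (π ∘ₗ LinearMap.inl ℤ _ _).toAddMonoidHom,
    (π ∘ₗ LinearMap.inr ℤ _ _).toAddMonoidHom, ?_, ?_, ?_⟩
  · refine AddMonoidHom.ext fun w ↦ ?_
    change π (α w, 0) = π (0, β w)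
    rw [← sub_eq_zero, ← map_sub]
    have : ((α w, 0) - (0, β w) : (Fin x → ℤ) × (Fin y → ℤ)) = f₀ w := by
      simp [f₀]
    rw [this]
    have : (LinearMap.range f₀).mkQ (f₀ w) = 0 := by simp
    simp only [π, LinearMap.comp_apply, this, map_zero]
  · intro z
    have hs : Function.Surjective π := e.surjective.comp
      ((Submodule.mkQ_surjective _).comp (Submodule.mkQ_surjective _))
    obtain ⟨⟨s, t⟩, h⟩ := hs z
    exact ⟨s, t, (hπ s t).trans h⟩
  · intro s t h
    replace h : π (s, t) = 0 := (hπ s t).symm.trans h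
    have h' : (LinearMap.range f₀).mkQ (s, t) ∈ Submodule.torsion ℤ M := by
      rw [← Submodule.Quotient.mk_eq_zero]
      exact e.map_eq_zero_iff.mp h
    obtain ⟨⟨a, ha⟩, h⟩ := (Submodule.mem_torsion_iff _).mp h'
    have ha0 : a ≠ 0 := nonZeroDivisors.ne_zero ha
    have h : a • (s, t) ∈ LinearMap.range f₀ := by
      rw [← Submodule.Quotient.mk_eq_zero]
      exact h
    have h2 : (a.natAbs : ℤ) • (s, t) ∈ LinearMap.range f₀ := by
      rcases Int.natAbs_eq a with h' | h'
      · rwa [← h']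
      · rw [h', neg_smul] at h
        exact (Submodule.neg_mem_iff _).mp h
    obtain ⟨w, hw⟩ := h2
    refine ⟨a.natAbs, Int.natAbs_pos.mpr ha0, w, ?_, ?_⟩
    · simpa [f₀] using (congr_arg Prod.fst hw).symm
    · simpa [f₀] using (congr_arg Prod.snd hw).symm

end Lattice

noncomputable section

section HomToΓ

variable {W W' : Scheme.{u}} {R S : CommRingCat.{u}}

/-- The homomorphism on global sections corresponding to a morphism to an affine scheme. -/
def homToΓ (φ : W ⟶ Spec R) : R ⟶ Γ(W, ⊤) := (Scheme.ΓSpecIso R).inv ≫ φ.appTop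

lemma homToΓ_comp (g : W' ⟶ W) (φ : W ⟶ Spec R) : homToΓ (g ≫ φ) = homToΓ φ ≫ g.appTop := by
  simp [homToΓ]

lemma homToΓ_comp_map (φ : W ⟶ Spec R) (f : S ⟶ R) :
    homToΓ (φ ≫ Spec.map f) = f ≫ homToΓ φ := by
  rw [homToΓ, homToΓ, Scheme.Hom.comp_appTop, ← Category.assoc, ← Category.assoc,
    Scheme.ΓSpecIso_inv_naturality]

lemma homToΓ_toSpecΓ_map (f : R ⟶ Γ(W, ⊤)) : homToΓ (W.toSpecΓ ≫ Spec.map f) = f := by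
  rw [homToΓ_comp_map]
  simp [homToΓ]

lemma hom_ext_of_homToΓ {φ ψ : W ⟶ Spec R} (h : homToΓ φ = homToΓ ψ) : φ = ψ := by
  refine ext_to_Spec ?_
  simpa [homToΓ] using h

end HomToΓ

namespace SplitTorus

variable (k : Type u) [Field k] {m n l : ℕ}

/-- The homomorphism of split tori given by a homomorphism of character lattices. -/
def map (α : (Fin n → ℤ) →+ (Fin m → ℤ)) : SplitTorus k m ⟶ SplitTorus k n :=
  ((bialgSpec (.of k)).map (.op (CommBialgCat.ofHom
    (AddMonoidAlgebra.mapDomainBialgHom k α)))).hom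

instance (α : (Fin n → ℤ) →+ (Fin m → ℤ)) : IsMonHom (map k α) :=
  ((bialgSpec (.of k)).map (.op (CommBialgCat.ofHom
    (AddMonoidAlgebra.mapDomainBialgHom k α)))).isMonHom_hom

lemma map_left (α : (Fin n → ℤ) →+ (Fin m → ℤ)) :
    (map k α).left = Spec.map (CommRingCat.ofHom
      (AddMonoidAlgebra.mapDomainRingHom k α)) := rfl

variable {k}

lemma exists_eq_map (φ : SplitTorus k m ⟶ SplitTorus k n) [IsMonHom φ] :
    ∃ α : (Fin n → ℤ) →+ (Fin m → ℤ), φ = map k α := by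
  let A (n : ℕ) : (CommBialgCat k)ᵒᵖ := .op (.of k (AddMonoidAlgebra k (Fin n → ℤ)))
  let φ' : (bialgSpec (.of k)).obj (A m) ⟶ (bialgSpec (.of k)).obj (A n) :=
    @Mon.Hom.mk _ _ _ _ _ φ ‹IsMonHom φ›
  obtain ⟨β, hβ⟩ := bialgSpec.fullyFaithful.map_surjective φ'
  let b : AddMonoidAlgebra k (Fin n → ℤ) →ₐc[k] AddMonoidAlgebra k (Fin m → ℤ) := β.unop.hom
  refine ⟨AddMonoidAlgebra.mapDomainOfBialgHom b, ?_⟩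
  have : β = .op (CommBialgCat.ofHom (AddMonoidAlgebra.mapDomainBialgHom k
      (AddMonoidAlgebra.mapDomainOfBialgHom b))) := by
    rw [AddMonoidAlgebra.mapDomainBialgHom_mapDomainOfBialgHom]
    rfl
  rw [this] at hβ
  exact congr_arg Mon.Hom.hom hβ.symm

/-- The function on `W` obtained by pulling back a character along a morphism to a split torus. -/
def char {W : Scheme.{u}} (φ : W ⟶ (SplitTorus k n).left) (u : Fin n → ℤ) : Γ(W, ⊤) :=
  (homToΓ (R := .of (AddMonoidAlgebra k (Fin n → ℤ))) φ).hom (AddMonoidAlgebra.single u 1)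

variable {W W' : Scheme.{u}} (φ : W ⟶ (SplitTorus k n).left)

lemma char_zero : char φ 0 = 1 :=
  map_one (homToΓ (R := .of (AddMonoidAlgebra k (Fin n → ℤ))) φ).hom

lemma char_add (u v : Fin n → ℤ) : char φ (u + v) = char φ u * char φ v := by
  rw [char, char, char, ← map_mul, AddMonoidAlgebra.single_mul_single, _root_.mul_one]

lemma char_nsmul (m : ℕ) (u : Fin n → ℤ) : char φ (m • u) = char φ u ^ m := by
  induction m with
  | zero => rw [zero_smul, char_zero, pow_zero]
  | succ m ih => rw [succ_nsmul, char_add, ih, pow_succ]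

lemma char_comp (g : W' ⟶ W) (u : Fin n → ℤ) : char (g ≫ φ) u = g.appTop (char φ u) := by
  exact congr($(homToΓ_comp (R := .of (AddMonoidAlgebra k (Fin n → ℤ))) g φ).hom
    (AddMonoidAlgebra.single u 1))

lemma char_comp_map (α : (Fin m → ℤ) →+ (Fin n → ℤ)) (u : Fin m → ℤ) :
    char (φ ≫ (map k α).left) u = char φ (α u) := by
  have := homToΓ_comp_map (R := .of (AddMonoidAlgebra k (Fin n → ℤ)))
    (S := .of (AddMonoidAlgebra k (Fin m → ℤ))) φ
    (CommRingCat.ofHom (AddMonoidAlgebra.mapDomainRingHom k α))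
  rw [char, map_left]
  refine congr($(this).hom (AddMonoidAlgebra.single u 1)).trans ?_
  rw [CommRingCat.hom_comp, RingHom.comp_apply, CommRingCat.hom_ofHom,
    AddMonoidAlgebra.mapDomainRingHom_apply, AddMonoidAlgebra.mapDomain_single]
  rfl

lemma ext_of_char {φ ψ : W ⟶ (SplitTorus k n).left}
    (h : φ ≫ (SplitTorus k n).hom = ψ ≫ (SplitTorus k n).hom)
    (hc : ∀ u, char φ u = char ψ u) : φ = ψ := by
  refine hom_ext_of_homToΓ (R := .of (AddMonoidAlgebra k (Fin n → ℤ))) ?_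
  ext1
  refine AddMonoidAlgebra.ringHom_ext (fun a ↦ ?_) hc
  have h₁ := congr_arg (homToΓ (R := .of k)) h
  have h₂ (φ : W ⟶ (SplitTorus k n).left) := homToΓ_comp_map (S := .of k)
    (R := .of (AddMonoidAlgebra k (Fin n → ℤ))) φ
    (CommRingCat.ofHom (algebraMap k (AddMonoidAlgebra k (Fin n → ℤ))))
  replace h₁ := (h₂ φ).symm.trans (h₁.trans (h₂ ψ))
  exact congr($(h₁).hom a)

lemma exists_char_eq (c : W ⟶ Spec (.of k)) (χ : Multiplicative (Fin n → ℤ) →* Γ(W, ⊤)) :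
    ∃ φ : W ⟶ (SplitTorus k n).left, φ ≫ (SplitTorus k n).hom = c ∧
      ∀ u, char φ u = χ (.ofAdd u) := by
  let : Algebra k Γ(W, ⊤) := (homToΓ c).hom.toAlgebra
  let θ : AddMonoidAlgebra k (Fin n → ℤ) →ₐ[k] Γ(W, ⊤) := AddMonoidAlgebra.lift k _ _ χ
  refine ⟨W.toSpecΓ ≫ Spec.map (CommRingCat.ofHom θ.toRingHom), ?_, fun u ↦ ?_⟩
  · refine hom_ext_of_homToΓ ?_
    refine (homToΓ_comp_map (R := .of (AddMonoidAlgebra k (Fin n → ℤ))) (S := .of k) _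
      (CommRingCat.ofHom (algebraMap k (AddMonoidAlgebra k (Fin n → ℤ))))).trans ?_
    refine (congr_arg (_ ≫ ·) (homToΓ_toSpecΓ_map (CommRingCat.ofHom θ.toRingHom))).trans ?_
    ext a
    exact θ.commutes a
  · refine congr($(homToΓ_toSpecΓ_map (CommRingCat.ofHom θ.toRingHom)).hom
      (AddMonoidAlgebra.single u 1)).trans ?_
    exact (AddMonoidAlgebra.lift_single _ _ _).trans (one_smul _ _)

lemma char_one (u : Fin n → ℤ) : char η[SplitTorus k n].left u = 1 := by
  have h : η ≫ map k (0 : (Fin n → ℤ) →+ (Fin n → ℤ)) = η := IsMonHom.one_hom _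
  have := char_comp_map η[SplitTorus k n].left (0 : (Fin n → ℤ) →+ (Fin n → ℤ)) u
  rw [← Over.comp_left, h] at this
  exact this.trans (char_zero _)

/-- A pair of morphisms to split tori lifts along the homomorphism of tori given by a surjective
homomorphism of lattices if the pulled back characters satisfy the relations. -/
lemma exists_lift {x y : ℕ} {p : (Fin x → ℤ) →+ (Fin n → ℤ)} {q : (Fin y → ℤ) →+ (Fin n → ℤ)}
    (hpq : ∀ z, ∃ s t, p s + q t = z) (u : W ⟶ (SplitTorus k x).left)
    (v : W ⟶ (SplitTorus k y).left)
    (huv : u ≫ (SplitTorus k x).hom = v ≫ (SplitTorus k y).hom)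
    (h : ∀ s t, p s + q t = 0 → char u s * char v t = 1) :
    ∃ w : W ⟶ (SplitTorus k n).left, w ≫ (map k p).left = u ∧ w ≫ (map k q).left = v := by
  have key {s t s' t'} (hs : p s + q t = p s' + q t') :
      char u s * char v t = char u s' * char v t' := by
    have h₀ := h (s - s') (t - t') (by
      rw [map_sub, map_sub, ← add_sub_add_comm, hs, sub_self])
    rw [← sub_add_cancel s s', ← sub_add_cancel t t', char_add, char_add,
      _root_.mul_mul_mul_comm, h₀, _root_.one_mul]
  choose s t hst using hpq
  let χ : Multiplicative (Fin n → ℤ) →* Γ(W, ⊤) :=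
    { toFun z := char u (s z.toAdd) * char v (t z.toAdd)
      map_one' := h _ _ (hst _)
      map_mul' z z' := by
        rw [_root_.mul_mul_mul_comm, ← char_add, ← char_add]
        refine key ?_
        rw [hst, map_add, map_add, add_add_add_comm, hst, hst]
        rfl }
  obtain ⟨w, hw, hχ⟩ := exists_char_eq (u ≫ (SplitTorus k x).hom) χ
  refine ⟨w, ext_of_char ?_ fun z ↦ ?_, ext_of_char ?_ fun z ↦ ?_⟩
  · rw [Category.assoc, Over.w, hw]
  · rw [char_comp_map, hχ]
    have := key (s := s (p z)) (t := t (p z)) (s' := z) (t' := 0) (by rw [hst, map_zero, add_zero])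
    rwa [char_zero, _root_.mul_one] at this
  · rw [Category.assoc, Over.w, hw, huv]
  · rw [char_comp_map, hχ]
    have := key (s := s (q z)) (t := t (q z)) (s' := 0) (t' := z) (by rw [hst, map_zero, zero_add])
    rwa [char_zero, _root_.one_mul] at this

lemma ext_of_comp_map {x y : ℕ} {p : (Fin x → ℤ) →+ (Fin n → ℤ)}
    {q : (Fin y → ℤ) →+ (Fin n → ℤ)} (hpq : ∀ z, ∃ s t, p s + q t = z)
    {w w' : W ⟶ (SplitTorus k n).left}
    (hp : w ≫ (map k p).left = w' ≫ (map k p).left)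
    (hq : w ≫ (map k q).left = w' ≫ (map k q).left) : w = w' := by
  refine ext_of_char ?_ fun z ↦ ?_
  · have := congr($hp ≫ (SplitTorus k x).hom)
    rwa [Category.assoc, Category.assoc, Over.w] at this
  · obtain ⟨s, t, rfl⟩ := hpq z
    rw [char_add, char_add, ← char_comp_map, ← char_comp_map, ← char_comp_map, ← char_comp_map,
      hp, hq]

lemma map_comp {x : ℕ} (α : (Fin m → ℤ) →+ (Fin n → ℤ)) (β : (Fin n → ℤ) →+ (Fin x → ℤ)) :
    map k β ≫ map k α = map k (β.comp α) := by
  refine Over.OverMorphism.ext (ext_of_char ?_ fun u ↦ ?_)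
  · rw [Over.w, Over.w]
  · rw [Over.comp_left, char_comp_map]
    have h (u : Fin n → ℤ) := char_comp_map (𝟙 (SplitTorus k x).left) β u
    have h' (u : Fin m → ℤ) := char_comp_map (𝟙 (SplitTorus k x).left) (β.comp α) u
    simp only [Category.id_comp] at h h'
    rw [h, h']
    rfl

end SplitTorus

end

noncomputable section

lemma SplitTorus.isIntegral_left (k : Type u) [Field k] (n : ℕ) :
    IsIntegral (SplitTorus k n).left :=
  inferInstanceAs (IsIntegral (Spec (.of (AddMonoidAlgebra k (Fin n → ℤ)))))

namespace AlgebraicGeometry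

lemma Scheme.Hom.radical_ker {W D : Scheme.{u}} [IsReduced W] (r : W ⟶ D) [QuasiCompact r] :
    r.ker.radical = r.ker := by
  ext U : 2
  rw [Scheme.IdealSheafData.radical_ideal, Scheme.Hom.ker_apply]
  exact (Ideal.isRadical_bot.comap (r.app U).hom).radical

/-- A morphism from a reduced scheme factors through the reduced closed subscheme structure on a
closed set containing its image. -/
lemma Scheme.IdealSheafData.exists_comp_subschemeι_vanishingIdeal {W D : Scheme.{u}}
    [IsReduced W] (r : W ⟶ D) [QuasiCompact r] (Z : TopologicalSpace.Closeds D) (h : ∀ w, r w ∈ Z) :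
    ∃ r' : W ⟶ (vanishingIdeal Z).subscheme, r' ≫ (vanishingIdeal Z).subschemeι = r := by
  refine ⟨IsClosedImmersion.lift (vanishingIdeal Z).subschemeι r ?_,
    IsClosedImmersion.lift_fac _ _ _⟩
  rw [ker_subschemeι]
  rw [← r.radical_ker, ← vanishingIdeal_support]
  refine vanishingIdeal_antimono ?_
  rw [← SetLike.coe_subset_coe, Scheme.Hom.support_ker]
  refine closure_minimal ?_ Z.isClosed
  rintro _ ⟨w, rfl⟩
  exact h w

instance Scheme.IdealSheafData.isReduced_subscheme_vanishingIdeal {D : Scheme.{u}}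
    (Z : TopologicalSpace.Closeds D) : IsReduced (vanishingIdeal Z).subscheme := by
  have (U : D.affineOpens) : IsReduced ((vanishingIdeal Z).subschemeCover.openCover.X U) := by
    have : _root_.IsReduced (Γ(D, U.1) ⧸ (vanishingIdeal Z).ideal U) := by
      rw [← Ideal.isRadical_iff_quotient_reduced, vanishingIdeal_ideal]
      exact (PrimeSpectrum.isRadical_vanishingIdeal _)
    exact inferInstanceAs (IsReduced (Spec (.of (Γ(D, U.1) ⧸ (vanishingIdeal Z).ideal U))))
  exact @AlgebraicGeometry.IsReduced.of_openCover _ (vanishingIdeal Z).subschemeCover.openCover this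

end AlgebraicGeometry

namespace ToricVariety

variable {k : Type u} [Field k] {X Y B : ToricVariety k} (f : X ⟶ B) (g : Y ⟶ B)

lemma isAffine_torus_left (X : ToricVariety k) : IsAffine X.torus.left := by
  obtain ⟨n, e, _⟩ := X.isSplit
  have : IsAffine (SplitTorus k n).left :=
    inferInstanceAs (IsAffine (Spec (.of (AddMonoidAlgebra k (Fin n → ℤ)))))
  have : IsIso e.hom.left := inferInstanceAs (IsIso ((Over.forget _).map e.hom))
  exact .of_isIso e.hom.left

instance : IsAffine (torusSchemeFiberProduct f g) :=
  have := X.isAffine_torus_left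
  have := Y.isAffine_torus_left
  have := B.isAffine_torus_left
  inferInstance

instance : IsReduced (torusFiberProduct f g) :=
  Scheme.IdealSheafData.isReduced_subscheme_vanishingIdeal _

/-- The inclusion of the identity component `T` into the fiber product of the dense tori. -/
def identityComponentι : torusFiberProduct f g ⟶ torusSchemeFiberProduct f g :=
  (identityComponentIdeal f g).subschemeι

instance : IsClosedImmersion (identityComponentι f g) :=
  inferInstanceAs (IsClosedImmersion (identityComponentIdeal f g).subschemeι)

lemma exists_comp_identityComponentι {W : Scheme.{u}} [IsReduced W] [CompactSpace W]
    [PreconnectedSpace W]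
    (r : W ⟶ torusSchemeFiberProduct f g) (w₀ : W)
    (h : r w₀ = torusSchemeFiberProductOne f g (IsLocalRing.closedPoint k)) :
    ∃ r' : W ⟶ torusFiberProduct f g, r' ≫ identityComponentι f g = r := by
  refine Scheme.IdealSheafData.exists_comp_subschemeι_vanishingIdeal r _ fun w ↦ ?_
  change r w ∈ connectedComponent _
  rw [← h]
  exact (isPreconnected_range r.continuous).subset_connectedComponent ⟨w₀, rfl⟩ ⟨w, rfl⟩

lemma comp_torusSchemeFiberProductOne_apply {S : Over (Spec (.of k))} [GrpObj S]
    (a : S ⟶ X.torus) (b : S ⟶ Y.torus) [IsMonHom a] [IsMonHom b]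
    (r : S.left ⟶ torusSchemeFiberProduct f g)
    (hra : r ≫ pullback.fst _ _ = a.left) (hrb : r ≫ pullback.snd _ _ = b.left) :
    r (η[S].left (IsLocalRing.closedPoint k)) =
      torusSchemeFiberProductOne f g (IsLocalRing.closedPoint k) := by
  have : η[S].left ≫ r = torusSchemeFiberProductOne f g := by
    refine pullback.hom_ext ?_ ?_
    · rw [Category.assoc, hra, ← Over.comp_left, IsMonHom.one_hom]
      exact (pullback.lift_fst _ _ _).symm
    · rw [Category.assoc, hrb, ← Over.comp_left, IsMonHom.one_hom]
      exact (pullback.lift_snd _ _ _).symm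
  rw [← this]
  rfl

/-- The relations between characters hold on the identity component. -/
lemma char_mul_char_eq_one {x y b : ℕ} (eX : X.torus ≅ SplitTorus k x) [IsMonHom eX.hom]
    (eY : Y.torus ≅ SplitTorus k y) [IsMonHom eY.hom]
    (eB : B.torus ≅ SplitTorus k b) {α : (Fin b → ℤ) →+ (Fin x → ℤ)}
    {β : (Fin b → ℤ) →+ (Fin y → ℤ)} (hα : f.torusHom ≫ eB.hom = eX.hom ≫ SplitTorus.map k α)
    (hβ : g.torusHom ≫ eB.hom = eY.hom ≫ SplitTorus.map k β)
    {s : Fin x → ℤ} {t : Fin y → ℤ} {m : ℕ} (hm : 0 < m) {w : Fin b → ℤ} (hs : m • s = α w)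
    (ht : m • t = -β w) :
    SplitTorus.char (identityComponentι f g ≫ pullback.fst _ _ ≫ eX.hom.left) s *
      SplitTorus.char (identityComponentι f g ≫ pullback.snd _ _ ≫ eY.hom.left) t = 1 := by
  let D := torusSchemeFiberProduct f g
  let u : D ⟶ (SplitTorus k x).left := pullback.fst _ _ ≫ eX.hom.left
  let v : D ⟶ (SplitTorus k y).left := pullback.snd _ _ ≫ eY.hom.left
  let h := SplitTorus.char u s * SplitTorus.char v t
  have huv : u ≫ (SplitTorus.map k α).left = v ≫ (SplitTorus.map k β).left := by
    dsimp only [u, v]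
    rw [Category.assoc, Category.assoc, ← Over.comp_left, ← Over.comp_left, ← hα, ← hβ,
      Over.comp_left, Over.comp_left, pullback.condition_assoc]
  have hpow : h ^ m = 1 := by
    rw [mul_pow, ← SplitTorus.char_nsmul, ← SplitTorus.char_nsmul, hs, ht,
      ← SplitTorus.char_comp_map, huv, SplitTorus.char_comp_map, ← SplitTorus.char_add,
      add_neg_cancel, SplitTorus.char_zero]
  have h1 : torusSchemeFiberProductOne f g (IsLocalRing.closedPoint k) ∉ D.basicOpen (h - 1) := by
    have hu : torusSchemeFiberProductOne f g ≫ u = η[SplitTorus k x].left := by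
      dsimp only [u, torusSchemeFiberProductOne]
      rw [pullback.lift_fst_assoc, ← Over.comp_left, IsMonHom.one_hom]
    have hv : torusSchemeFiberProductOne f g ≫ v = η[SplitTorus k y].left := by
      dsimp only [v, torusSchemeFiberProductOne]
      rw [pullback.lift_snd_assoc, ← Over.comp_left, IsMonHom.one_hom]
    have h0 : (torusSchemeFiberProductOne f g).appTop (h - 1) = 0 := by
      rw [map_sub, map_mul, map_one, ← SplitTorus.char_comp, ← SplitTorus.char_comp, hu, hv,
        SplitTorus.char_one, SplitTorus.char_one, _root_.mul_one, sub_self]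
    intro hmem
    have : IsLocalRing.closedPoint k ∈
      (torusSchemeFiberProductOne f g) ⁻¹ᵁ D.basicOpen (h - 1) := hmem
    rw [Scheme.preimage_basicOpen_top, h0, Scheme.basicOpen_zero] at this
    exact this
  have key : (identityComponentι f g).appTop (h - 1) = 0 := by
    rw [← AlgebraicGeometry.basicOpen_eq_bot_iff, ← Scheme.preimage_basicOpen_top, eq_bot_iff]
    intro z hz
    refine notMem_basicOpen_sub_one_of_mem_connectedComponent (k := k) (u ≫ (SplitTorus k x).hom) h
      hm hpow h1 ?_ hz
    exact (identityComponentIdeal f g).range_subschemeι.le ⟨z, rfl⟩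
  rwa [map_sub, map_one, map_mul, ← SplitTorus.char_comp, ← SplitTorus.char_comp,
    sub_eq_zero] at key

/-- The identity component of the fiber product of the dense tori is a split torus. -/
lemma exists_torusFiberProduct_iso :
    ∃ (n : ℕ) (a : SplitTorus k n ⟶ X.torus) (b : SplitTorus k n ⟶ Y.torus)
      (e : (SplitTorus k n).left ≅ torusFiberProduct f g), IsMonHom a ∧ IsMonHom b ∧
      a ≫ f.torusHom = b ≫ g.torusHom ∧
      e.hom ≫ identityComponentι f g ≫ pullback.fst _ _ = a.left ∧
      e.hom ≫ identityComponentι f g ≫ pullback.snd _ _ = b.left := by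
  obtain ⟨x, eX, _⟩ := X.isSplit
  obtain ⟨y, eY, _⟩ := Y.isSplit
  obtain ⟨b, eB, _⟩ := B.isSplit
  obtain ⟨α, hα⟩ := SplitTorus.exists_eq_map (eX.inv ≫ f.torusHom ≫ eB.hom)
  obtain ⟨β, hβ⟩ := SplitTorus.exists_eq_map (eY.inv ≫ g.torusHom ≫ eB.hom)
  rw [Iso.inv_comp_eq] at hα hβ
  obtain ⟨n, p, q, hpq, hsurj, hker⟩ := exists_lattice_pushout α β
  let a : SplitTorus k n ⟶ X.torus := SplitTorus.map k p ≫ eX.inv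
  let a' : SplitTorus k n ⟶ Y.torus := SplitTorus.map k q ≫ eY.inv
  have hab : a ≫ f.torusHom = a' ≫ g.torusHom := by
    rw [← cancel_mono eB.hom]
    simp only [a, a', Category.assoc, hα, hβ, Iso.inv_hom_id_assoc, SplitTorus.map_comp, hpq]
  let r : (SplitTorus k n).left ⟶ torusSchemeFiberProduct f g :=
    pullback.lift a.left a'.left (by rw [← Over.comp_left, hab, Over.comp_left])
  have : IsMonHom a := inferInstanceAs (IsMonHom (_ ≫ _))
  have : IsMonHom a' := inferInstanceAs (IsMonHom (_ ≫ _))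
  have hra : r ≫ pullback.fst _ _ = a.left := pullback.lift_fst _ _ _
  have hrb : r ≫ pullback.snd _ _ = a'.left := pullback.lift_snd _ _ _
  have : IsIntegral (SplitTorus k n).left := SplitTorus.isIntegral_left k n
  have : CompactSpace (SplitTorus k n).left :=
    inferInstanceAs (CompactSpace (Spec (.of (AddMonoidAlgebra k (Fin n → ℤ)))))
  obtain ⟨r', hr'⟩ := exists_comp_identityComponentι f g r _
    (comp_torusSchemeFiberProductOne_apply f g a a' r hra hrb)
  obtain ⟨w, hw₁, hw₂⟩ := SplitTorus.exists_lift hsurj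
    (identityComponentι f g ≫ pullback.fst _ _ ≫ eX.hom.left)
    (identityComponentι f g ≫ pullback.snd _ _ ≫ eY.hom.left) (by
      simp only [Category.assoc, Over.w]
      rw [← Over.w f.torusHom, ← Over.w g.torusHom, pullback.condition_assoc]) fun s t hst ↦ by
      obtain ⟨m, hm, z, hs, ht⟩ := hker s t hst
      exact char_mul_char_eq_one f g eX eY eB hα hβ hm hs ht
  have ha : a.left ≫ eX.hom.left = (SplitTorus.map k p).left := by
    rw [← Over.comp_left]; simp [a]
  have ha' : a'.left ≫ eY.hom.left = (SplitTorus.map k q).left := by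
    rw [← Over.comp_left]; simp [a']
  have h₁ : w ≫ r' = 𝟙 _ := by
    rw [← cancel_mono (identityComponentι f g), Category.assoc, hr', Category.id_comp]
    refine pullback.hom_ext ?_ ?_
    · rw [Category.assoc, hra, ← cancel_mono eX.hom.left, Category.assoc, ha, hw₁, Category.assoc]
    · rw [Category.assoc, hrb, ← cancel_mono eY.hom.left, Category.assoc, ha', hw₂, Category.assoc]
  have h₂ : r' ≫ w = 𝟙 _ := by
    refine SplitTorus.ext_of_comp_map hsurj ?_ ?_
    · rw [Category.assoc, hw₁, reassoc_of% hr', reassoc_of% hra, ha, Category.id_comp]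
    · rw [Category.assoc, hw₂, reassoc_of% hr', reassoc_of% hrb, ha', Category.id_comp]
  refine ⟨n, a, a', ⟨r', w, h₂, h₁⟩, ‹_›, ‹_›, hab, ?_, ?_⟩
  · dsimp only; rw [reassoc_of% hr', hra]
  · dsimp only; rw [reassoc_of% hr', hrb]

end ToricVariety

end

noncomputable section

section IntegralClosure

/-- The integral closure of a ring in an integrally closed domain is integrally closed. -/
lemma isIntegrallyClosed_integralClosure (A B : Type*) [CommRing A] [CommRing B] [IsDomain B]
    [IsIntegrallyClosed B] [Algebra A B] : IsIntegrallyClosed (integralClosure A B) := by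
  let C := integralClosure A B
  have hinj : Function.Injective (algebraMap C B) := Subtype.val_injective
  let K := FractionRing C
  let L := FractionRing B
  have hCL : Function.Injective ((algebraMap B L).comp (algebraMap C B)) :=
    (IsFractionRing.injective B L).comp hinj
  let φ : K →+* L := IsFractionRing.lift hCL
  have hφ (c : C) : φ (algebraMap C K c) = algebraMap B L (algebraMap C B c) :=
    IsFractionRing.lift_algebraMap hCL c
  refine (isIntegrallyClosed_iff K).mpr fun {x} hx ↦ ?_
  obtain ⟨p, hp, hpx⟩ := hx
  have h₁ : IsIntegral B (φ x) := by
    refine ⟨p.map (algebraMap C B), hp.map _, ?_⟩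
    have : (algebraMap B L).comp (algebraMap C B) = φ.comp (algebraMap C K) :=
      RingHom.ext fun c ↦ (hφ c).symm
    rw [Polynomial.eval₂_map, this, ← Polynomial.hom_eval₂, hpx, map_zero]
  obtain ⟨b, hb⟩ := (isIntegrallyClosed_iff L).mp ‹_› h₁
  have h₂ : IsIntegral C b := by
    refine ⟨p, hp, IsFractionRing.injective B L ?_⟩
    have : (algebraMap B L).comp (algebraMap C B) = φ.comp (algebraMap C K) :=
      RingHom.ext fun c ↦ (hφ c).symm
    rw [Polynomial.hom_eval₂, this, hb, ← Polynomial.hom_eval₂, hpx, map_zero, map_zero]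
  have h₃ : b ∈ C := isIntegral_trans (R := A) (A := C) b h₂
  refine ⟨⟨b, h₃⟩, φ.injective ?_⟩
  rw [hφ, ← hb]
  rfl

end IntegralClosure

namespace IsNormalScheme

open AlgebraicGeometry

lemma isIntegrallyClosed_of_isAffineOpen {X : Scheme.{u}} [IsIntegral X] [IsNormalScheme X]
    {U : X.Opens} [Nonempty U] (hU : IsAffineOpen U) : IsIntegrallyClosed Γ(X, U) := by
  refine .of_localization_maximal fun p _ _ ↦ ?_
  let y : PrimeSpectrum Γ(X, U) := ⟨p, inferInstance⟩
  have hy : hU.fromSpec y ∈ U := (hU.isoSpec.inv _).2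
  let : Algebra Γ(X, U) (X.presheaf.stalk (hU.fromSpec y)) :=
    TopCat.Presheaf.algebra_section_stalk X.presheaf ⟨_, hy⟩
  have : IsLocalization.AtPrime (X.presheaf.stalk (hU.fromSpec y)) p :=
    hU.isLocalization_stalk' y hy
  have := isIntegrallyClosed_stalk (hU.fromSpec y)
  exact .of_equiv (IsLocalization.algEquiv p.primeCompl (X.presheaf.stalk (hU.fromSpec y))
    (Localization.AtPrime p)).toRingEquiv

lemma of_forall_exists_isAffineOpen {X : Scheme.{u}}
    (h : ∀ x : X, ∃ U : X.Opens, x ∈ U ∧ IsAffineOpen U ∧ IsDomain Γ(X, U) ∧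
      IsIntegrallyClosed Γ(X, U)) : IsNormalScheme X := by
  have key (x : X) : IsDomain (X.presheaf.stalk x) ∧ IsIntegrallyClosed (X.presheaf.stalk x) := by
    obtain ⟨U, hx, hU, _, _⟩ := h x
    let : Algebra Γ(X, U) (X.presheaf.stalk x) :=
      TopCat.Presheaf.algebra_section_stalk X.presheaf ⟨x, hx⟩
    have : IsLocalization.AtPrime (X.presheaf.stalk x) (hU.primeIdealOf ⟨x, hx⟩).asIdeal :=
      hU.isLocalization_stalk ⟨x, hx⟩
    have hle := (hU.primeIdealOf ⟨x, hx⟩).asIdeal.primeCompl_le_nonZeroDivisors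
    exact ⟨IsLocalization.isDomain_of_le_nonZeroDivisors _ hle,
      isIntegrallyClosed_of_isLocalization _ _ hle⟩
  exact ⟨fun x ↦ (key x).1, fun x ↦ (key x).2⟩

lemma splitTorus (k : Type u) [Field k] (n : ℕ) : IsNormalScheme (SplitTorus k n).left := by
  let R : CommRingCat.{u} := .of (AddMonoidAlgebra k (Fin n → ℤ))
  have h₁ : IsDomain R := inferInstanceAs (IsDomain (AddMonoidAlgebra k (Fin n → ℤ)))
  have h₂ : IsIntegrallyClosed R :=
    inferInstanceAs (IsIntegrallyClosed (AddMonoidAlgebra k (Fin n → ℤ)))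
  refine of_forall_exists_isAffineOpen (X := Spec R) fun x ↦ ⟨⊤, trivial, isAffineOpen_top _, ?_, ?_⟩
  · exact (Scheme.ΓSpecIso R).commRingCatIsoToRingEquiv.toMulEquiv.isDomain _
  · exact .of_equiv (Scheme.ΓSpecIso R).commRingCatIsoToRingEquiv.symm

end IsNormalScheme

namespace AlgebraicGeometry

/-- Two morphisms over a base to a separated scheme agree if they agree after composition with a
scheme-theoretically dominant morphism. -/
lemma ext_of_isSchemeTheoreticallyDominant_of_isSeparated {U W Y S : Scheme.{u}} {f g : W ⟶ Y}
    (s : Y ⟶ S) [IsSeparated s] (h : f ≫ s = g ≫ s) (j : U ⟶ W) [IsSchemeTheoreticallyDominant j]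
    (hj : j ≫ f = j ≫ g) : f = g := by
  let W' : Over S := Over.mk (f ≫ s)
  let Y' : Over S := Over.mk s
  let U' : Over S := Over.mk (j ≫ f ≫ s)
  let f' : W' ⟶ Y' := Over.homMk f
  let g' : W' ⟶ Y' := Over.homMk g
  let j' : U' ⟶ W' := Over.homMk j
  have : IsSeparated Y'.hom := ‹_›
  let l : U ⟶ (equalizer f' g').left := (equalizer.lift j' (by ext1; exact hj)).left
  have hl : l ≫ (equalizer.ι f' g').left = j := by
    rw [← Over.comp_left, equalizer.lift_ι]
    rfl
  have : (equalizer.ι f' g').left.ker = ⊥ := by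
    rw [← le_bot_iff, ← j.ker_eq_bot, ← hl]
    exact Scheme.Hom.le_ker_comp _ _
  have := (IsClosedImmersion.isIso_iff_ker_eq_bot (f := (equalizer.ι f' g').left)).mpr this
  rw [← cancel_epi (equalizer.ι f' g').left]
  exact congr($(equalizer.condition f' g').left)

lemma llp_isIntegralHom_of_isIso_fromNormalization {U W : Scheme.{u}} (j : U ⟶ W) [QuasiCompact j]
    [QuasiSeparated j] [IsIso j.fromNormalization] :
    (MorphismProperty.llp @IsIntegralHom) j := by
  intro Z F π (hπ : IsIntegralHom π)
  refine ⟨fun {s φ} sq ↦ ?_⟩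
  let l : U ⟶ pullback φ π := pullback.lift j s sq.w.symm
  have hl : j = l ≫ pullback.fst φ π := (pullback.lift_fst _ _ _).symm
  have hid : inv j.fromNormalization ≫ j.normalizationDesc l (pullback.fst φ π) hl ≫
      pullback.fst φ π = 𝟙 W := by
    rw [Scheme.Hom.normalizationDesc_comp, IsIso.inv_hom_id]
  have hj : j ≫ inv j.fromNormalization = j.toNormalization := by
    rw [IsIso.comp_inv_eq, Scheme.Hom.toNormalization_fromNormalization]
  refine ⟨⟨⟨inv j.fromNormalization ≫ j.normalizationDesc l (pullback.fst φ π) hl ≫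
    pullback.snd φ π, ?_, ?_⟩⟩⟩
  · rw [reassoc_of% hj, Scheme.Hom.toNormalization_normalizationDesc_assoc]
    exact pullback.lift_snd _ _ _
  · rw [Category.assoc, Category.assoc, ← pullback.condition, reassoc_of% hid]

/-- The sections of an open subscheme over an affine open embed in the fraction field. -/
lemma exists_injective_toFractionRing {U W : Scheme.{u}} (j : U ⟶ W) [IsOpenImmersion j]
    [IsIntegral W] [Nonempty U] {V : W.Opens} [Nonempty V] (hV : IsAffineOpen V) :
    ∃ ψ : Γ(U, j ⁻¹ᵁ V) →+* FractionRing Γ(W, V), Function.Injective ψ ∧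
      ψ.comp (j.app V).hom = algebraMap _ _ := by
  have : IsIntegral U := isIntegral_of_isOpenImmersion j
  have hg : j (genericPoint U) = genericPoint W := genericPoint_eq_of_isOpenImmersion j
  have hgV : genericPoint W ∈ V :=
    ((genericPoint_spec W).mem_open_set_iff V.isOpen).mpr (by simpa using ‹Nonempty V›)
  have key (y : W) (hy : y ∈ V) (h : y = genericPoint W) :
      letI := TopCat.Presheaf.algebra_section_stalk W.presheaf ⟨y, hy⟩
      IsFractionRing Γ(W, V) (W.presheaf.stalk y) := by
    subst h
    exact functionField_isFractionRing_of_isAffineOpen W V hV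
  have hy : j (genericPoint U) ∈ V := by rwa [hg]
  let := TopCat.Presheaf.algebra_section_stalk W.presheaf ⟨_, hy⟩
  have : IsFractionRing Γ(W, V) (W.presheaf.stalk (j (genericPoint U))) := key _ hy hg
  let e : W.presheaf.stalk (j (genericPoint U)) ≃ₐ[Γ(W, V)] FractionRing Γ(W, V) :=
    IsLocalization.algEquiv (nonZeroDivisors Γ(W, V)) _ _
  let ψ : Γ(U, j ⁻¹ᵁ V) ⟶ W.presheaf.stalk (j (genericPoint U)) :=
    U.presheaf.germ (j ⁻¹ᵁ V) (genericPoint U) hy ≫ inv (j.stalkMap (genericPoint U))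
  have hψ : j.app V ≫ ψ = W.presheaf.germ V _ hy := by
    rw [← Category.assoc, IsIso.comp_inv_eq]
    exact (j.germ_stalkMap V _ hy).symm
  refine ⟨(e : _ →+* _).comp ψ.hom, ?_, ?_⟩
  · refine e.injective.comp ?_
    have : Function.Injective (inv (j.stalkMap (genericPoint U))) :=
      (ConcreteCategory.bijective_of_isIso (inv (j.stalkMap (genericPoint U)))).1
    exact this.comp (germ_injective_of_isIntegral _ _ _)
  · ext x
    exact (congr_arg e congr($(hψ).hom x)).trans (e.commutes x)

/-- A normal integral scheme is its own normalization in a nonempty open subscheme. -/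
lemma isIso_fromNormalization_of_isOpenImmersion {U W : Scheme.{u}} (j : U ⟶ W) [QuasiCompact j]
    [IsOpenImmersion j] [IsIntegral W] [IsNormalScheme W] [Nonempty U] :
    IsIso j.fromNormalization := by
  apply IsZariskiLocalAtTarget.of_forall_exists_morphismRestrict (P := .isomorphisms _) fun x ↦ ?_
  obtain ⟨_, ⟨V, hV, rfl⟩, hxV, -⟩ := W.isBasis_affineOpens.exists_subset_of_mem_open
    (Set.mem_univ x) isOpen_univ
  refine ⟨V, hxV, (isIso_morphismRestrict_iff_isIso_app _ hV).mpr ?_⟩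
  rw [j.fromNormalization_app hV]
  let : Algebra Γ(W, V) Γ(U, j ⁻¹ᵁ V) := (j.app V).hom.toAlgebra
  have : Nonempty V := ⟨⟨x, hxV⟩⟩
  have := IsNormalScheme.isIntegrallyClosed_of_isAffineOpen hV
  obtain ⟨ψ, hinj, hψ⟩ := exists_injective_toFractionRing j hV
  suffices h : Function.Bijective (algebraMap Γ(W, V) (integralClosure Γ(W, V) Γ(U, j ⁻¹ᵁ V))) by
    have : IsIso (CommRingCat.ofHom
      (algebraMap Γ(W, V) (integralClosure Γ(W, V) Γ(U, j ⁻¹ᵁ V)))) :=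
      (RingEquiv.ofBijective _ h).toCommRingCatIso.isIso_hom
    exact IsIso.comp_isIso
  have hψ' (a : Γ(W, V)) : ψ (algebraMap _ _ a) = algebraMap _ (FractionRing Γ(W, V)) a :=
    congr($hψ a)
  refine ⟨fun a b hab ↦ ?_, fun b ↦ ?_⟩
  · refine IsFractionRing.injective Γ(W, V) (FractionRing Γ(W, V)) ?_
    rw [← hψ', ← hψ']
    exact congr_arg (fun z : integralClosure Γ(W, V) Γ(U, j ⁻¹ᵁ V) ↦ ψ z.1) hab
  · let ψ' : Γ(U, j ⁻¹ᵁ V) →ₐ[Γ(W, V)] FractionRing Γ(W, V) := { ψ with commutes' := hψ' }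
    obtain ⟨a, ha⟩ := (isIntegrallyClosed_iff (FractionRing Γ(W, V))).mp ‹_› (b.2.map ψ')
    exact ⟨a, Subtype.ext (hinj ((hψ' a).trans ha))⟩

/-- The relative normalization in a normal integral scheme is normal. -/
lemma isNormalScheme_normalization {U W : Scheme.{u}} (j : U ⟶ W) [IsAffineHom j]
    [IsIntegral U] [IsNormalScheme U] : IsNormalScheme j.normalization := by
  refine .of_forall_exists_isAffineOpen fun z ↦ ?_
  obtain ⟨_, ⟨V, hV, rfl⟩, hzV, -⟩ := W.isBasis_affineOpens.exists_subset_of_mem_open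
    (Set.mem_univ (j.fromNormalization z)) isOpen_univ
  have : Nonempty (j ⁻¹ᵁ V : U.Opens) := by
    obtain ⟨_, hV', u, rfl⟩ := j.toNormalization.denseRange.inter_open_nonempty
      (j.fromNormalization ⁻¹ᵁ V) (j.fromNormalization ⁻¹ᵁ V).isOpen ⟨z, hzV⟩
    refine ⟨⟨u, ?_⟩⟩
    rw [← j.toNormalization_fromNormalization]
    exact hV'
  have := IsNormalScheme.isIntegrallyClosed_of_isAffineOpen (hV.preimage j)
  let : Algebra Γ(W, V) Γ(U, j ⁻¹ᵁ V) := (j.app V).hom.toAlgebra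
  have := isIntegrallyClosed_integralClosure Γ(W, V) Γ(U, j ⁻¹ᵁ V)
  let e := (j.normalizationObjIso hV).commRingCatIsoToRingEquiv
  exact ⟨j.fromNormalization ⁻¹ᵁ V, hzV, hV.preimage _, e.toMulEquiv.isDomain _,
    .of_equiv e.symm⟩

/-- The normalization of an integral scheme of finite type over a field in an open subscheme is
finite. -/
lemma isFinite_fromNormalization {k : Type u} [Field k] {U W : Scheme.{u}} (j : U ⟶ W)
    [QuasiCompact j] [IsOpenImmersion j] [IsIntegral W] [Nonempty U]
    (c : W ⟶ Spec (.of k)) [LocallyOfFiniteType c] : IsFinite j.fromNormalization := by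
  refine (isFinite_iff _).mpr ⟨inferInstance, fun V hV ↦ ?_⟩
  let : Algebra Γ(W, V) Γ(U, j ⁻¹ᵁ V) := (j.app V).hom.toAlgebra
  suffices h : Module.Finite Γ(W, V) (integralClosure Γ(W, V) Γ(U, j ⁻¹ᵁ V)) by
    rw [j.fromNormalization_app hV, CommRingCat.hom_comp]
    exact .comp (.of_surjective _ (j.normalizationObjIso hV).symm.commRingCatIsoToRingEquiv.surjective)
      (RingHom.finite_algebraMap.mpr h)
  cases isEmpty_or_nonempty V with
  | inl h =>
    have hV' : j ⁻¹ᵁ V = ⊥ := by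
      ext u
      exact iff_of_false (fun hu ↦ h.false ⟨_, hu⟩) id
    have : Subsingleton Γ(U, j ⁻¹ᵁ V) := by
      rw [hV']
      infer_instance
    infer_instance
  | inr h =>
    obtain ⟨ψ, hinj, hψ⟩ := exists_injective_toFractionRing j hV
    let φ : k →+* Γ(W, V) := ((Scheme.ΓSpecIso (.of k)).inv ≫ c.appLE ⊤ V le_top).hom
    let : Algebra k Γ(W, V) := φ.toAlgebra
    have : Algebra.FiniteType k Γ(W, V) := by
      have : φ.FiniteType := (c.finiteType_appLE (isAffineOpen_top _) hV le_top).comp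
        (.of_surjective _ (Scheme.ΓSpecIso (.of k)).symm.commRingCatIsoToRingEquiv.surjective)
      exact this
    have := finite_integralClosure_of_finiteType k Γ(W, V) (FractionRing Γ(W, V))
      (FractionRing Γ(W, V))
    have : IsNoetherianRing Γ(W, V) := Algebra.FiniteType.isNoetherianRing k _
    let ψ' : Γ(U, j ⁻¹ᵁ V) →ₐ[Γ(W, V)] FractionRing Γ(W, V) :=
      { ψ with commutes' := fun a ↦ congr($hψ a) }
    let χ : integralClosure Γ(W, V) Γ(U, j ⁻¹ᵁ V) →ₗ[Γ(W, V)]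
        integralClosure Γ(W, V) (FractionRing Γ(W, V)) :=
      { toFun x := ⟨ψ' x, x.2.map ψ'⟩
        map_add' x y := Subtype.ext (map_add ψ' _ _)
        map_smul' r x := Subtype.ext (map_smul ψ' _ _) }
    exact Module.Finite.of_injective χ fun x y hxy ↦
      Subtype.ext (hinj congr(($hxy).1))

lemma isNormalization_fromNormalization {U W : Scheme.{u}} (j : U ⟶ W) [IsAffineHom j]
    [IsOpenImmersion j] [IsIntegral W] [IsIntegral U] [IsNormalScheme U]
    [IsOpenImmersion j.toNormalization] : IsNormalization j.fromNormalization := by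
  have hg : j.fromNormalization (genericPoint j.normalization) = genericPoint W := by
    rw [← genericPoint_eq_of_isOpenImmersion j.toNormalization, ← Scheme.Hom.comp_apply,
      j.toNormalization_fromNormalization, genericPoint_eq_of_isOpenImmersion j]
  have key (z : j.normalization) (hz : j.toNormalization (genericPoint U) = z) :
      IsIso (j.fromNormalization.stalkMap z) := by
    subst hz
    have : IsOpenImmersion (j.toNormalization ≫ j.fromNormalization) := by
      rwa [j.toNormalization_fromNormalization]
    have : IsIso (j.fromNormalization.stalkMap (j.toNormalization (genericPoint U)) ≫
        j.toNormalization.stalkMap (genericPoint U)) := by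
      rw [← Scheme.Hom.stalkMap_comp]
      exact inferInstanceAs (IsIso ((j.toNormalization ≫ j.fromNormalization).stalkMap _))
    exact IsIso.of_isIso_comp_right _ (j.toNormalization.stalkMap (genericPoint U))
  exact
    { isNormal := isNormalScheme_normalization j
      isIntegralHom := inferInstance
      map_genericPoint := hg
      isIso_functionField := key _ (genericPoint_eq_of_isOpenImmersion j.toNormalization) }

instance isIntegral_image {X Y : Scheme.{u}} (f : X ⟶ Y) [QuasiCompact f] [IsIntegral X] :
    IsIntegral f.image := by
  have : IrreducibleSpace f.image := by
    rw [irreducibleSpace_def]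
    convert ((IrreducibleSpace.isIrreducible_univ X).image _
      f.toImage.continuous.continuousOn).closure
    simpa using f.toImage.denseRange.closure_range.symm
  have : IsReduced f.image := by
    have h : f.ker = Scheme.IdealSheafData.vanishingIdeal f.ker.support := by
      rw [Scheme.IdealSheafData.vanishingIdeal_support, f.radical_ker]
    have := Scheme.IdealSheafData.isReduced_subscheme_vanishingIdeal f.ker.support
    rwa [← h] at this
  exact isIntegral_of_irreducibleSpace_of_isReduced _

end AlgebraicGeometry

end

noncomputable section

namespace AlgebraicGeometry

section Over

variable {S : Scheme.{u}} (R : Over S) {U W : Over S} (j : U ⟶ W)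

lemma isPullback_whiskerLeft_left :
    IsPullback (R ◁ j).left (pullback.snd R.hom U.hom) (pullback.snd R.hom W.hom) j.left := by
  refine .of_right (h₁₂ := pullback.fst R.hom W.hom) (v₁₃ := R.hom) (h₂₂ := W.hom) ?_
    (Over.whiskerLeft_left_snd j) (.of_hasPullback _ _)
  rw [Over.whiskerLeft_left_fst, Over.w]
  exact .of_hasPullback R.hom U.hom

instance [IsOpenImmersion j.left] : IsOpenImmersion (R ◁ j).left :=
  MorphismProperty.of_isPullback (isPullback_whiskerLeft_left R j).flip ‹_›

instance [QuasiCompact j.left] : QuasiCompact (R ◁ j).left :=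
  MorphismProperty.of_isPullback (isPullback_whiskerLeft_left R j).flip ‹_›

instance [Flat R.hom] [IsSchemeTheoreticallyDominant j.left] [QuasiCompact j.left] :
    IsSchemeTheoreticallyDominant (R ◁ j).left :=
  .of_isPullback (isPullback_whiskerLeft_left R j).flip

lemma llp_isIntegralHom_whiskerLeft_left [Smooth R.hom] [QuasiCompact j.left]
    [QuasiSeparated j.left] [IsIso j.left.fromNormalization] :
    (MorphismProperty.llp @IsIntegralHom) (R ◁ j).left := by
  have h : IsIso (pullback.snd j.left (pullback.snd R.hom W.hom)).fromNormalization := by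
    rw [← Scheme.Hom.normalizationPullback_snd]
    infer_instance
  have := llp_isIntegralHom_of_isIso_fromNormalization
    (pullback.snd j.left (pullback.snd R.hom W.hom))
  rw [← (isPullback_whiskerLeft_left R j).flip.isoPullback_hom_snd]
  exact (MorphismProperty.llp_isMultiplicative _).comp_mem _ _ (MorphismProperty.llp_of_isIso _ _) this

lemma Over.ext_of_isSchemeTheoreticallyDominant {Y : Over S} [IsSeparated Y.hom] {f g : W ⟶ Y}
    [IsSchemeTheoreticallyDominant j.left] (h : j ≫ f = j ≫ g) : f = g :=
  Over.OverMorphism.ext <| ext_of_isSchemeTheoreticallyDominant_of_isSeparated Y.hom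
    ((Over.w f).trans (Over.w g).symm) j.left congr(($h).left)

lemma Over.exists_lift {X Y B Z : Over S} {f : X ⟶ B} {g : Y ⟶ B}
    (hj : (MorphismProperty.llp @IsIntegralHom) j.left) {p : Z ⟶ X} {q : Z ⟶ Y}
    (π : Z.left ⟶ pullback f.left g.left) [hπ : IsIntegralHom π]
    (hp : π ≫ pullback.fst _ _ = p.left) (hq : π ≫ pullback.snd _ _ = q.left)
    (s : U ⟶ Z) (x : W ⟶ X) (y : W ⟶ Y) (hxy : x ≫ f = y ≫ g)
    (hx : s ≫ p = j ≫ x) (hy : s ≫ q = j ≫ y) :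
    ∃ ψ : W ⟶ Z, j ≫ ψ = s ∧ ψ ≫ p = x ∧ ψ ≫ q = y := by
  have := hj _ hπ
  have hxy' : x.left ≫ f.left = y.left ≫ g.left := congr(($hxy).left)
  have sq : CommSq s.left j.left π (pullback.lift x.left y.left hxy') := by
    refine ⟨pullback.hom_ext ?_ ?_⟩
    · rw [Category.assoc, Category.assoc, hp, pullback.lift_fst]
      exact congr(($hx).left)
    · rw [Category.assoc, Category.assoc, hq, pullback.lift_snd]
      exact congr(($hy).left)
  have h₁ : sq.lift ≫ p.left = x.left := by
    rw [← hp, sq.fac_right_assoc, pullback.lift_fst]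
  have h₂ : sq.lift ≫ q.left = y.left := by
    rw [← hq, sq.fac_right_assoc, pullback.lift_snd]
  refine ⟨Over.homMk sq.lift ?_, ?_, ?_, ?_⟩
  · rw [← Over.w p, reassoc_of% h₁, Over.w]
  · ext1; exact sq.fac_left
  · ext1; exact h₁
  · ext1; exact h₂

end Over

end AlgebraicGeometry

instance (k : Type u) [Field k] (n : ℕ) : Smooth (SplitTorus k n).hom := by
  have : (algebraMap k (AddMonoidAlgebra k (Fin n → ℤ))).Smooth :=
    RingHom.smooth_algebraMap.mpr inferInstance
  exact (HasRingHomProperty.Spec_iff (P := @Smooth)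
    (φ := CommRingCat.ofHom (algebraMap k (AddMonoidAlgebra k (Fin n → ℤ))))).mpr this

namespace ToricVariety

variable {k : Type u} [Field k] {X Y B : ToricVariety k} (f : X ⟶ B) (g : Y ⟶ B)

instance : Smooth X.torus.hom := by
  obtain ⟨n, e, _⟩ := X.isSplit
  rw [← Over.w e.hom]
  have : IsIso e.hom.left := inferInstanceAs (IsIso ((Over.forget _).map e.hom))
  infer_instance

instance : QuasiCompact X.incl.left := by
  have := X.isAffine_torus_left
  have : QuasiSeparatedSpace X.carrier.left := quasiSeparatedSpace_of_quasiSeparated X.carrier.hom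
  infer_instance

instance nonempty_torus_left : Nonempty X.torus.left :=
  ⟨η[X.torus].left (IsLocalRing.closedPoint k)⟩

lemma _root_.AlgebraicGeometry.isSchemeTheoreticallyDominant_of_isOpenImmersion {U W : Scheme.{u}}
    (j : U ⟶ W) [IsOpenImmersion j] [IsIntegral W] [Nonempty U] :
    IsSchemeTheoreticallyDominant j := by
  have : IsDominant j := ⟨j.isOpenEmbedding.isOpen_range.dense (Set.range_nonempty _)⟩
  exact .of_isDominant _

instance : IsSchemeTheoreticallyDominant X.incl.left :=
  isSchemeTheoreticallyDominant_of_isOpenImmersion _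

lemma whiskerLeft_tensorHom_act {T Z : Over (Spec (.of k))} [MonObj T] {i : T ⟶ Z}
    {a : T ⟶ X.torus} [IsMonHom a] {p : Z ⟶ X.carrier} (h : i ≫ p = a ≫ X.incl) :
    (T ◁ i) ≫ (a ⊗ₘ p) ≫ X.act = μ[T] ≫ a ≫ X.incl := by
  rw [IsMonHom.mul_hom_assoc, ← X.act_incl, ← id_tensorHom, ← id_tensorHom,
    tensorHom_comp_tensorHom_assoc, tensorHom_comp_tensorHom_assoc, Category.id_comp,
    Category.comp_id, h]

/-- Let `Z` be a normal variety containing a split torus `T` as an open subscheme, where `T` is the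
fiber product of the tori of `X` and `Y` over the torus of `B`. If `Z` is integral over the
scheme-theoretic fiber product of `X` and `Y` over `B`, then it is a fiber product of `X` and `Y`
over `B` in the category of toric varieties. -/
lemma exists_isPullback {n : ℕ} (a : SplitTorus k n ⟶ X.torus) (b : SplitTorus k n ⟶ Y.torus)
    [IsMonHom a] [IsMonHom b] (hab : a ≫ f.torusHom = b ≫ g.torusHom)
    (ext : ∀ {U : Over (Spec (.of k))} {t t' : U ⟶ SplitTorus k n}, t ≫ a = t' ≫ a →
      t ≫ b = t' ≫ b → t = t')
    (lift : ∀ (U : ToricVariety k) (u : U ⟶ X) (v : U ⟶ Y), u ≫ f = v ≫ g →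
      ∃ t : U.torus ⟶ SplitTorus k n, t ≫ a = u.torusHom ∧ t ≫ b = v.torusHom)
    (Z : Over (Spec (.of k))) [IsIntegral Z.left] [IsNormalScheme Z.left] [IsSeparated Z.hom]
    [LocallyOfFiniteType Z.hom] [QuasiCompact Z.hom] (i : SplitTorus k n ⟶ Z)
    [IsOpenImmersion i.left] [QuasiCompact i.left] (p : Z ⟶ X.carrier) (q : Z ⟶ Y.carrier)
    (π : Z.left ⟶ schemeFiberProduct f g) [IsIntegralHom π]
    (hπp : π ≫ pullback.fst _ _ = p.left) (hπq : π ≫ pullback.snd _ _ = q.left)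
    (hp : i ≫ p = a ≫ X.incl) (hq : i ≫ q = b ≫ Y.incl) {N : Scheme.{u}} (ν : Z.left ⟶ N)
    (hν : IsNormalization ν) (c : N ⟶ X.scheme) (d : N ⟶ Y.scheme) (hc : ν ≫ c = p.left)
    (hd : ν ≫ d = q.left) :
    ∃ (Z' : ToricVariety k) (p' : Z' ⟶ X) (q' : Z' ⟶ Y), IsPullback p' q' f g ∧
      ∃ ν' : Z'.scheme ⟶ N, IsNormalization ν' ∧ ν' ≫ c = schemeHom p' ∧ ν' ≫ d = schemeHom q' := by
  have hpq : p ≫ f.hom = q ≫ g.hom := by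
    ext1
    rw [Over.comp_left, Over.comp_left, ← hπp, ← hπq, Category.assoc, Category.assoc,
      pullback.condition]
  let T := SplitTorus k n
  have : Nonempty T.left := ⟨η[T].left (IsLocalRing.closedPoint k)⟩
  have : IsSchemeTheoreticallyDominant i.left := isSchemeTheoreticallyDominant_of_isOpenImmersion _
  have : IsIso i.left.fromNormalization := isIso_fromNormalization_of_isOpenImmersion _
  obtain ⟨act, hact, hactp, hactq⟩ := Over.exists_lift (T ◁ i) (f := f.hom) (g := g.hom)
    (llp_isIntegralHom_whiskerLeft_left T i) π hπp hπq (μ[T] ≫ i) ((a ⊗ₘ p) ≫ X.act)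
    ((b ⊗ₘ q) ≫ Y.act)
    (by
      rw [Category.assoc, Category.assoc, f.act_hom, g.act_hom, tensorHom_comp_tensorHom_assoc,
        tensorHom_comp_tensorHom_assoc, hab, hpq])
    (by rw [Category.assoc, hp, whiskerLeft_tensorHom_act hp])
    (by rw [Category.assoc, hq, whiskerLeft_tensorHom_act hq])
  let Z' : ToricVariety k :=
    { carrier := Z
      torus := T
      isSplit := ⟨n, Iso.refl _, inferInstanceAs (IsMonHom (𝟙 _))⟩
      incl := i
      act := act
      one_act := by
        refine Over.ext_of_isSchemeTheoreticallyDominant (𝟙_ _ ◁ i) ?_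
        rw [whisker_exchange_assoc, hact, MonObj.one_mul_assoc, leftUnitor_naturality]
      mul_act := by
        refine Over.ext_of_isSchemeTheoreticallyDominant ((T ⊗ T) ◁ i) ?_
        rw [whisker_exchange_assoc, hact, MonObj.mul_assoc_assoc]
        rw [tensor_whiskerLeft_assoc, Iso.inv_hom_id_assoc, ← whiskerLeft_comp_assoc, hact,
          whiskerLeft_comp_assoc, hact]
      act_incl := hact }
  let p' : Z' ⟶ X := { hom := p, torusHom := a, incl_hom := hp, act_hom := hactp }
  let q' : Z' ⟶ Y := { hom := q, torusHom := b, incl_hom := hq, act_hom := hactq }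
  have w : p' ≫ f = q' ≫ g := Hom.ext hpq hab
  have hex (W : ToricVariety k) (u : W ⟶ X) (v : W ⟶ Y) (huv : u ≫ f = v ≫ g) :
      ∃ l : W ⟶ Z', l ≫ p' = u ∧ l ≫ q' = v := by
    obtain ⟨t, hta, htb⟩ := lift W u v huv
    have : IsIso W.incl.left.fromNormalization := isIso_fromNormalization_of_isOpenImmersion _
    obtain ⟨ψ, h₁, h₂, h₃⟩ := Over.exists_lift W.incl (f := f.hom) (g := g.hom)
      (llp_isIntegralHom_of_isIso_fromNormalization _) π hπp hπq (t ≫ i) u.hom v.hom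
      congr(Hom.hom $huv) (by rw [Category.assoc, hp, reassoc_of% hta, u.incl_hom])
      (by rw [Category.assoc, hq, reassoc_of% htb, v.incl_hom])
    have : IsMonHom t :=
      { one_hom := by
          refine ext ?_ ?_
          · rw [Category.assoc, hta, IsMonHom.one_hom, IsMonHom.one_hom]
          · rw [Category.assoc, htb, IsMonHom.one_hom, IsMonHom.one_hom]
        mul_hom := by
          refine ext ?_ ?_
          · rw [Category.assoc, hta, IsMonHom.mul_hom, Category.assoc, IsMonHom.mul_hom,
              tensorHom_comp_tensorHom_assoc, hta]
          · rw [Category.assoc, htb, IsMonHom.mul_hom, Category.assoc, IsMonHom.mul_hom,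
              tensorHom_comp_tensorHom_assoc, htb] }
    refine ⟨{ hom := ψ, torusHom := t, incl_hom := h₁, act_hom := ?_ }, Hom.ext h₂ hta,
      Hom.ext h₃ htb⟩
    refine Over.ext_of_isSchemeTheoreticallyDominant (W.torus ◁ W.incl) (Y := Z) ?_
    rw [← Category.assoc, W.act_incl, Category.assoc, h₁]
    exact (whiskerLeft_tensorHom_act (X := Z') (i := W.incl) (a := t) (p := ψ) h₁).symm
  have huniq (W : ToricVariety k) (l l' : W ⟶ Z') (h₁ : l ≫ p' = l' ≫ p')
      (h₂ : l ≫ q' = l' ≫ q') : l = l' := by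
    have ht : l.torusHom = l'.torusHom :=
      ext congr(Hom.torusHom $h₁) congr(Hom.torusHom $h₂)
    refine Hom.ext (Over.ext_of_isSchemeTheoreticallyDominant W.incl (Y := Z) ?_) ht
    exact l.incl_hom.trans (congr($ht ≫ i).trans l'.incl_hom.symm)
  refine ⟨Z', p', q', ⟨⟨w⟩, ⟨PullbackCone.IsLimit.mk _
    (fun s ↦ (hex _ s.fst s.snd s.condition).choose)
    (fun s ↦ (hex _ s.fst s.snd s.condition).choose_spec.1)
    (fun s ↦ (hex _ s.fst s.snd s.condition).choose_spec.2) fun s m h₁ h₂ ↦ huniq _ _ _ ?_ ?_⟩⟩,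
    ν, hν, hc, hd⟩
  · rw [h₁, (hex _ s.fst s.snd s.condition).choose_spec.1]
  · rw [h₂, (hex _ s.fst s.snd s.condition).choose_spec.2]

end ToricVariety

end

noncomputable section

namespace ToricVariety

variable {k : Type u} [Field k] {X Y B : ToricVariety k} (f : X ⟶ B) (g : Y ⟶ B)

instance : IsSeparated (schemeHom f) := by
  have : IsSeparated (schemeHom f ≫ B.carrier.hom) := by
    rw [Over.w]; infer_instance
  exact .of_comp _ B.carrier.hom

instance : LocallyOfFiniteType (schemeHom f) := by
  have : LocallyOfFiniteType (schemeHom f ≫ B.carrier.hom) := by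
    rw [Over.w]; infer_instance
  exact locallyOfFiniteType_of_comp _ B.carrier.hom

instance : QuasiCompact (schemeHom f) := by
  have : QuasiCompact (schemeHom f ≫ B.carrier.hom) := by
    rw [Over.w]; infer_instance
  exact .of_comp _ B.carrier.hom

lemma torusFiberProductι_fst : torusFiberProductι f g ≫ pullback.fst _ _ =
    identityComponentι f g ≫ pullback.fst _ _ ≫ X.incl.left := by
  have h : torusSchemeFiberProductι f g ≫ pullback.fst _ _ = pullback.fst _ _ ≫ X.incl.left :=
    pullback.lift_fst _ _ _
  exact (Category.assoc _ _ _).trans (congr_arg (identityComponentι f g ≫ ·) h)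

lemma torusFiberProductι_snd : torusFiberProductι f g ≫ pullback.snd _ _ =
    identityComponentι f g ≫ pullback.snd _ _ ≫ Y.incl.left := by
  have h : torusSchemeFiberProductι f g ≫ pullback.snd _ _ = pullback.snd _ _ ≫ Y.incl.left :=
    pullback.lift_snd _ _ _
  exact (Category.assoc _ _ _).trans (congr_arg (identityComponentι f g ≫ ·) h)

instance : IsImmersion (torusFiberProductι f g) := by
  have : IsImmersion (identityComponentι f g) := inferInstance
  have : IsImmersion (torusSchemeFiberProductι f g) := inferInstance
  exact inferInstanceAs (IsImmersion (identityComponentι f g ≫ torusSchemeFiberProductι f g))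

instance : IsAffine (torusFiberProduct f g) :=
  isAffine_of_isAffineHom (identityComponentι f g)

instance : IsClosedImmersion (torusClosureι f g) :=
  inferInstanceAs (IsClosedImmersion (Scheme.IdealSheafData.subschemeι _))

/-- The structure morphism of the scheme-theoretic fiber product. -/
abbrev schemeFiberProductHom : schemeFiberProduct f g ⟶ Spec (.of k) :=
  pullback.fst _ _ ≫ X.carrier.hom

lemma schemeFiberProduct_snd_hom :
    pullback.snd (schemeHom f) (schemeHom g) ≫ Y.carrier.hom = schemeFiberProductHom f g := by
  rw [schemeFiberProductHom, ← Over.w f.hom, ← Over.w g.hom, pullback.condition_assoc]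

instance : QuasiCompact (torusFiberProductι f g) := by
  have : QuasiSeparatedSpace (schemeFiberProduct f g) :=
    quasiSeparatedSpace_of_quasiSeparated (schemeFiberProductHom f g)
  infer_instance

lemma exists_torusHom_lift {n : ℕ} {a : SplitTorus k n ⟶ X.torus} {b : SplitTorus k n ⟶ Y.torus}
    (e : (SplitTorus k n).left ≅ torusFiberProduct f g)
    (hea : e.hom ≫ identityComponentι f g ≫ pullback.fst _ _ = a.left)
    (heb : e.hom ≫ identityComponentι f g ≫ pullback.snd _ _ = b.left)
    (U : ToricVariety k) (u : U ⟶ X) (v : U ⟶ Y) (huv : u ≫ f = v ≫ g) :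
    ∃ t : U.torus ⟶ SplitTorus k n, t ≫ a = u.torusHom ∧ t ≫ b = v.torusHom := by
  have : IsIntegral U.torus.left := isIntegral_of_isOpenImmersion U.incl.left
  have := U.isAffine_torus_left
  let r : U.torus.left ⟶ torusSchemeFiberProduct f g :=
    pullback.lift u.torusHom.left v.torusHom.left congr((Hom.torusHom $huv).left)
  obtain ⟨r', hr'⟩ := exists_comp_identityComponentι f g r _
    (comp_torusSchemeFiberProductOne_apply f g u.torusHom v.torusHom r
      (pullback.lift_fst _ _ _) (pullback.lift_snd _ _ _))
  have h₁ : (r' ≫ e.inv) ≫ a.left = u.torusHom.left := by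
    rw [← hea, Category.assoc, e.inv_hom_id_assoc, reassoc_of% hr']
    exact pullback.lift_fst _ _ _
  have h₂ : (r' ≫ e.inv) ≫ b.left = v.torusHom.left := by
    rw [← heb, Category.assoc, e.inv_hom_id_assoc, reassoc_of% hr']
    exact pullback.lift_snd _ _ _
  refine ⟨Over.homMk (r' ≫ e.inv) ?_, ?_, ?_⟩
  · rw [← Over.w a, ← Category.assoc, h₁, Over.w]
  · ext1; exact h₁
  · ext1; exact h₂

end ToricVariety

end

theorem mainTheorem7 {k : Type u} [Field k] {X Y B : ToricVariety k} (f : X ⟶ B) (g : Y ⟶ B) :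
    ∃ (Z : ToricVariety k) (p : Z ⟶ X) (q : Z ⟶ Y),
      IsPullback p q f g ∧
      ∃ ν : Z.scheme ⟶ ToricVariety.torusClosure f g,
        IsNormalization ν ∧
        ν ≫ ToricVariety.torusClosureι f g ≫ pullback.fst _ _ = ToricVariety.schemeHom p ∧
        ν ≫ ToricVariety.torusClosureι f g ≫ pullback.snd _ _ = ToricVariety.schemeHom q := by
  open ToricVariety in
  obtain ⟨n, a, b, e, _, _, hab, hea, heb⟩ := exists_torusFiberProduct_iso f g
  have : IsIntegral (SplitTorus k n).left := SplitTorus.isIntegral_left k n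
  have : IsNormalScheme (SplitTorus k n).left := .splitTorus k n
  have : Nonempty (SplitTorus k n).left := inferInstance
  have : Nonempty (torusFiberProduct f g) := ‹Nonempty (SplitTorus k n).left›.map e.hom
  have : IsIntegral (torusFiberProduct f g) := isIntegral_of_isOpenImmersion e.inv
  have : IsAffine (SplitTorus k n).left := .of_isIso e.hom
  have : IsIntegral (torusClosure f g) := isIntegral_image (torusFiberProductι f g)
  let c : torusClosure f g ⟶ Spec (.of k) := torusClosureι f g ≫ schemeFiberProductHom f g
  let j₀ : torusFiberProduct f g ⟶ torusClosure f g := (torusFiberProductι f g).toImage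
  have : IsOpenImmersion j₀ := inferInstanceAs (IsOpenImmersion (torusFiberProductι f g).toImage)
  let j : (SplitTorus k n).left ⟶ torusClosure f g := e.hom ≫ j₀
  have hj : j ≫ torusClosureι f g = e.hom ≫ torusFiberProductι f g :=
    (Category.assoc _ _ _).trans (congr_arg (e.hom ≫ ·) (torusFiberProductι f g).toImage_imageι)
  have hja : j ≫ torusClosureι f g ≫ pullback.fst _ _ = a.left ≫ X.incl.left := by
    rw [reassoc_of% hj, torusFiberProductι_fst, ← hea, Category.assoc, Category.assoc]
  have hjb : j ≫ torusClosureι f g ≫ pullback.snd _ _ = b.left ≫ Y.incl.left := by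
    rw [reassoc_of% hj, torusFiberProductι_snd, ← heb, Category.assoc, Category.assoc]
  have : IsAffineHom j := by
    have : IsAffineHom (j ≫ c) := inferInstance
    exact MorphismProperty.of_postcomp (W := @IsAffineHom) (W' := @IsSeparated) j c inferInstance this
  have : IsOpenImmersion j := inferInstance
  have := isFinite_fromNormalization j c
  have hν := isNormalization_fromNormalization j
  have := hν.isNormal
  let Z : Over (Spec (.of k)) := Over.mk (j.fromNormalization ≫ c)
  have : IsIntegral Z.left := inferInstanceAs (IsIntegral j.normalization)
  have : IsNormalScheme Z.left := hν.isNormal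
  have : IsSeparated Z.hom := inferInstanceAs (IsSeparated (j.fromNormalization ≫ c))
  have : LocallyOfFiniteType Z.hom := inferInstanceAs (LocallyOfFiniteType (j.fromNormalization ≫ c))
  have : QuasiCompact Z.hom := inferInstanceAs (QuasiCompact (j.fromNormalization ≫ c))
  let i : SplitTorus k n ⟶ Z := Over.homMk j.toNormalization (by
    change j.toNormalization ≫ j.fromNormalization ≫ torusClosureι f g ≫ pullback.fst _ _ ≫ _ = _
    rw [j.toNormalization_fromNormalization_assoc, reassoc_of% hja, Over.w, Over.w])
  let p : Z ⟶ X.carrier := Over.homMk (j.fromNormalization ≫ torusClosureι f g ≫ pullback.fst _ _)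
    (by simp [Z, c])
  let q : Z ⟶ Y.carrier := Over.homMk (j.fromNormalization ≫ torusClosureι f g ≫ pullback.snd _ _)
    (by simp [Z, c, schemeFiberProduct_snd_hom])
  have : IsOpenImmersion i.left := inferInstanceAs (IsOpenImmersion j.toNormalization)
  have : QuasiCompact i.left := inferInstanceAs (QuasiCompact j.toNormalization)
  refine exists_isPullback f g a b hab ?_ (exists_torusHom_lift f g e hea heb) Z i p q
    (j.fromNormalization ≫ torusClosureι f g) (Category.assoc _ _ _) (Category.assoc _ _ _) ?_ ?_
    j.fromNormalization hν _ _ rfl rfl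
  · intro U t t' ha hb
    refine Over.OverMorphism.ext ?_
    rw [← cancel_mono e.hom, ← cancel_mono (identityComponentι f g)]
    refine pullback.hom_ext ?_ ?_
    · rw [Category.assoc, Category.assoc, hea, Category.assoc, Category.assoc, hea]
      exact congr(($ha).left)
    · rw [Category.assoc, Category.assoc, heb, Category.assoc, Category.assoc, heb]
      exact congr(($hb).left)
  · ext1
    exact (j.toNormalization_fromNormalization_assoc _).trans hja
  · ext1
    exact (j.toNormalization_fromNormalization_assoc _).trans hjb
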